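/- Let $\mathbb{R}_m$ (also written $Cl_m$) be the real Clifford algebra generated by the standard basis $e_1,\dots,e_m$ of $\mathbb{R}^m$ with $e_ie_j+e_je_i=-2\delta_{ij}$, normed by $|\sum_A x_Ae_A|=(\sum_A x_A^2)^{1/2}$. Identify $\mathbb{R}^{m+1}$ with the paravectors $x=x_0+\underline{x}$, $\underline{x}=\sum_{j=1}^m x_je_j$, and put $\bar x=x_0-\underline{x}$, $\mathrm{Re}\,x=x_0$. Let $\mathbb{S}=\{I=\sum_{j=1}^m x_je_j:\ |I|=1\}$, and for $I\in\mathbb{S}$ let $\mathbb{C}_I=\{u+Iv:\ u,v\in\mathbb{R}\}$, with area element $dV_I$. Let $D\subset\mathbb{C}$ be open and invariant under complex conjugation, $\Omega_D=\{u+Jv:\ u+iv\in D,\ J\in\mathbb{S}\}$ and $\Omega_I=\Omega_D\cap\mathbb{C}_I$. Assume that $\Omega_D$ is bounded and does not meet the real line. Let $$S^{-1}(q,x)=-(q^2-2\,\mathrm{Re}(x)\,q+|x|^2)^{-1}(q-\bar x),\qquad T_{\Omega_I}f(q)=-\frac1{2\pi}\int_{\Omega_I}S^{-1}(q,x)f(x)\,dV_I(x),$$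 $$G=\frac{\partial}{\partial x_0}+\frac{\underline{x}}{|\underline{x}|^2}\sum_{j=1}^m x_j\frac{\partial}{\partial x_j}.$$ A function $f:\Omega_D\to Cl_m$ is a (left) slice function if there are $F_1,F_2:D\to Cl_m$ with $F_1(\bar z)=F_1(z)$, $F_2(\bar z)=-F_2(z)$ and $f(u+Jv)=F_1(z)+JF_2(z)$ for all $z=u+iv\in D$ and $J\in\mathbb{S}$. Let $f\in C^1(\overline{\Omega_D})$ with values in $Cl_m$, that is, $f$ is differentiable on $\Omega_D$, and $f$ and its derivative extend continuously to $\overline{\Omega_D}$. Let $I\in\mathbb{S}$. For $q\in\Omega_D$ write $\zeta=|\underline{q}|$, $q=q_0+I_q\zeta$, $q_{\pm I}=q_0\pm I\zeta$, $\alpha=\frac{1-I_qI}{2}$, $\beta=\frac{1+I_qI}{2}$; let $\partial_\zeta$ denote differentiation in $\zeta$ with $q_0$ and $I_q$ fixed; and let $\mathrm{p.v.}\!\int_{\Omega_I}$ be the limit as $\varepsilon\to0^+$ of the integrals over $\Omega_I\setminus(B(q_I,\varepsilon)\cup B(q_{-I},\varepsilon))$. Then for every $q\in\Omega_D$ the integral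 defining $T_{\Omega_I}f(q)$ converges absolutely, the following derivatives and principal values exist, and $$2\pi\,\partial_{q_0}T_{\Omega_I}f(q)=-\,\mathrm{p.v.}\!\int_{\Omega_I}\frac{\partial S^{-1}(q,x)}{\partial q_0}f(x)\,dV_I(x)+\pi\big[\alpha f(q_I)+\beta f(q_{-I})\big],$$ $$2\pi\,\partial_{q_i}T_{\Omega_I}f(q)=-\,\mathrm{p.v.}\!\int_{\Omega_I}\frac{\partial S^{-1}(q,x)}{\partial q_i}f(x)\,dV_I(x)-\frac{q_i}{|\underline{q}|}\,\pi\big[\alpha If(q_I)-\beta If(q_{-I})\big],\qquad i=1,\dots,m,$$ $$2\pi\,\partial_{\zeta}T_{\Omega_I}f(q)=-\,\mathrm{p.v.}\!\int_{\Omega_I}\frac{\partial S^{-1}(q,x)}{\partial \zeta}f(x)\,dV_I(x)-\pi\big[\alpha If(q_I)-\beta If(q_{-I})\big],$$ $$G_qT_{\Omega_I}f(q)=\alpha f(q_I)+\beta f(q_{-I}).$$ If $f$ is moreover a slice function on $\Omega_D$, then $G_qT_{\Omega_I}f(q)=f(q)$ for all $q\in\Omega_D$. -/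

import Mathlib

open Topology

noncomputable section

namespace SliceClifford

/-- The `m`-dimensional Euclidean space of 1-vectors. -/
abbrev Vec (m : ℕ) : Type := EuclideanSpace ℝ (Fin m)

/-- The quadratic form `v ↦ -|v|²` on `ℝ^m`. -/
def negSq (m : ℕ) : QuadraticForm ℝ (Vec m) :=
  -(LinearMap.BilinMap.toQuadraticMap (innerₗ (Vec m)))

/-- The real Clifford algebra `Cl_m`, generated by `ℝ^m` with `v² = -|v|²`,
equivalently `e_i e_j + e_j e_i = -2 δ_ij`. -/
abbrev Cl (m : ℕ) : Type := CliffordAlgebra (negSq m)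

/-- The inclusion of the 1-vectors into `Cl_m`. -/
def vecCl {m : ℕ} (v : Vec m) : Cl m := CliffordAlgebra.ι (negSq m) v

/-- The standard basis `e_A` of `Cl_m`, `A ⊆ {1, …, m}`. -/
def stdBasis (m : ℕ) : Module.Basis (Finset (Fin m)) ℝ (Cl m) :=
  (EuclideanSpace.basisFun (Fin m) ℝ).toBasis.ExteriorAlgebra.map
    (CliffordAlgebra.equivExterior (negSq m)).symm

/-- The coordinates `(x_A)_A` of `x = ∑ x_A e_A`. -/
def coords (m : ℕ) : Cl m ≃ₗ[ℝ] EuclideanSpace ℝ (Finset (Fin m)) :=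
  (stdBasis m).equivFun.trans (WithLp.linearEquiv 2 ℝ (Finset (Fin m) → ℝ)).symm

/-- The norm `|x| = (∑ x_A²)^(1/2)` on `Cl_m`. -/
instance instNormedAddCommGroupCl (m : ℕ) : NormedAddCommGroup (Cl m) :=
  NormedAddCommGroup.induced (Cl m) (EuclideanSpace ℝ (Finset (Fin m))) (coords m)
    (coords m).injective

instance instNormedSpaceCl (m : ℕ) : NormedSpace ℝ (Cl m) :=
  NormedSpace.induced ℝ (Cl m) (EuclideanSpace ℝ (Finset (Fin m))) (coords m)

theorem vecCl_mul_self {m : ℕ} (v : Vec m) :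
    vecCl v * vecCl v = algebraMap ℝ (Cl m) (-‖v‖ ^ 2) := by
  rw [vecCl, CliffordAlgebra.ι_sq_scalar]
  congr 1
  simp [negSq]

theorem contractLeft_prod_eq_zero {m : ℕ} (d : Module.Dual ℝ (Vec m)) (l : List (Vec m))
    (h : ∀ v ∈ l, d v = 0) :
    CliffordAlgebra.contractLeft (Q := (0 : QuadraticForm ℝ (Vec m))) d
      ((l.map (CliffordAlgebra.ι (0 : QuadraticForm ℝ (Vec m)))).prod) = 0 := by
  induction l with
  | nil => simp
  | cons a l ih =>
    rw [List.map_cons, List.prod_cons, CliffordAlgebra.contractLeft_ι_mul,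
      ih (fun v hv => h v (List.mem_cons_of_mem _ hv)), h a (by simp)]
    simp

theorem equivExterior_prod {m : ℕ} (l : List (Vec m))
    (h : l.Pairwise (fun v w => inner ℝ v w = 0)) :
    CliffordAlgebra.equivExterior (negSq m) ((l.map vecCl).prod) =
      (l.map (CliffordAlgebra.ι (0 : QuadraticForm ℝ (Vec m)))).prod := by
  induction l with
  | nil =>
    rw [CliffordAlgebra.equivExterior, CliffordAlgebra.changeFormEquiv_apply]
    exact CliffordAlgebra.changeForm_one _
  | cons a l ih =>
    rw [List.pairwise_cons] at h
    have := ih h.2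
    rw [CliffordAlgebra.equivExterior, CliffordAlgebra.changeFormEquiv_apply] at this ⊢
    rw [List.map_cons, List.prod_cons, vecCl, CliffordAlgebra.changeForm_ι_mul, this,
      List.map_cons, List.prod_cons, contractLeft_prod_eq_zero, sub_zero]
    intro v hv
    have h1 := h.1 v hv
    have h2 : inner ℝ v a = 0 := by rw [real_inner_comm]; exact h1
    simp [QuadraticMap.associated_apply, negSq, inner_add_right, h1, h2]

/-- `e_A` is the product of the `e_i`, `i ∈ A`, in increasing order. -/
theorem stdBasis_apply (m : ℕ) (A : Finset (Fin m)) :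
    stdBasis m A =
      ((A.sort (· ≤ ·)).map (fun i => vecCl (EuclideanSpace.single i (1 : ℝ)))).prod := by
  have h : (A.sort (· ≤ ·)).map (fun i => vecCl (EuclideanSpace.single i (1 : ℝ))) =
      ((A.sort (· ≤ ·)).map (fun i => EuclideanSpace.single i (1 : ℝ))).map vecCl := by
    simp
  rw [h, stdBasis, Module.Basis.map_apply, LinearEquiv.symm_apply_eq, equivExterior_prod,
    ExteriorAlgebra.basis_apply_ofCard _ (rfl : A.card = A.card)]
  · refine (ExteriorAlgebra.ιMulti_apply (R := ℝ) _).trans ?_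
    rw [List.ofFn_eq_map, List.map_map, ← Finset.listMap_orderEmbOfFin_finRange A rfl, List.map_map]
    simp [Function.comp_def, Set.powersetCard.ofFinEmbEquiv_symm_apply]
  · rw [List.pairwise_map]
    refine (Finset.sort_nodup A (· ≤ ·)).imp ?_
    intro i j hij
    simp [EuclideanSpace.inner_single_left, hij]

theorem norm_sq_eq {m : ℕ} (x : Cl m) : ‖x‖ ^ 2 = ∑ A, ((stdBasis m).repr x A) ^ 2 := by
  change ‖coords m x‖ ^ 2 = _
  rw [EuclideanSpace.norm_sq_eq]
  simp [coords]

instance instFiniteDimensionalCl (m : ℕ) : FiniteDimensional ℝ (Cl m) :=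
  (stdBasis m).finiteDimensional_of_finite

/-- The space `ℝ^(m+1)` of paravectors `x = (x_0, x_1, …, x_m)`. -/
abbrev Para (m : ℕ) : Type := EuclideanSpace ℝ (Fin (m + 1))

/-- The 1-vector part `(x_1, …, x_m)` of a paravector. -/
def vec {m : ℕ} (x : Para m) : Vec m := WithLp.toLp 2 (fun i => x i.succ)

/-- The paravector `x_0 + x_1 e_1 + … + x_m e_m` as an element of `Cl_m`. -/
def paraCl {m : ℕ} (x : Para m) : Cl m := algebraMap ℝ (Cl m) (x 0) + vecCl (vec x)

/-- `ℝ^(m+1)` without the real line. -/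
def nonreal (m : ℕ) : Set (Para m) := {x | vec x ≠ 0}

/-- The direction `I_x = vec x / |vec x|` of a nonreal paravector. -/
def unitVec {m : ℕ} (x : Para m) : Vec m := ‖vec x‖⁻¹ • vec x

/-- The paravector `u + J v`, for `z = u + i v`. For `|J| = 1` the map `z ↦ u + J v` is an isometry
of `ℂ` onto the plane `ℂ_J`. -/
def slicePt {m : ℕ} (J : Vec m) (z : ℂ) : Para m :=
  WithLp.toLp 2 (Fin.cons z.re (fun i => z.im * J i))

/-- The axially symmetric set `Ω_D`, the union over all unit vectors `J` of
`{u + J v : u + i v ∈ D}`. -/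
def axialSet (m : ℕ) (D : Set ℂ) : Set (Para m) :=
  ⋃ J ∈ Metric.sphere (0 : Vec m) 1, slicePt J '' D

/-- The set `{z : u + I v ∈ Ω}`, that is `Ω ∩ ℂ_I` in the coordinate `z = u + i v` of `ℂ_I`. -/
def planeSet {m : ℕ} (Ω : Set (Para m)) (I : Vec m) : Set ℂ := slicePt I ⁻¹' Ω

/-- The coordinate `q_0 + i |vec q|` of a paravector in its own plane. -/
def planeCoord {m : ℕ} (q : Para m) : ℂ := ⟨q 0, ‖vec q‖⟩

/-- The Cauchy kernel `S⁻¹(q, x) = -(q² - 2 Re(x) q + |x|²)⁻¹ (q - conj x)`. On `Cl_m`, `star` is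
the Clifford conjugation, and `Ring.inverse` is the inverse of an invertible element. -/
def cauchyKernel {m : ℕ} (q x : Para m) : Cl m :=
  -(Ring.inverse (paraCl q ^ 2 - (2 * x 0) • paraCl q + algebraMap ℝ (Cl m) (‖x‖ ^ 2)) *
    (paraCl q - star (paraCl x)))

/-- The partial derivative `∂S⁻¹(q, x)/∂q_j`, `j = 0, …, m`. -/
def kernelPartial {m : ℕ} (j : Fin (m + 1)) (q x : Para m) : Cl m :=
  lineDeriv ℝ (fun p => cauchyKernel p x) q (EuclideanSpace.single j 1)

/-- The derivative of `h` at `q` in `ζ = |vec q|`, where `q = q_0 + I_q ζ`, for fixed `q_0` and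
`I_q`. -/
def HasRadialDeriv {m : ℕ} (h : Para m → Cl m) (h' : Cl m) (q : Para m) : Prop :=
  HasDerivAt (fun ζ : ℝ => h (slicePt (unitVec q) ⟨q 0, ζ⟩)) h' ‖vec q‖

/-- The derivative `∂S⁻¹(q, x)/∂ζ`, `ζ = |vec q|`, for fixed `q_0` and `I_q`. -/
def kernelRadial {m : ℕ} (q x : Para m) : Cl m :=
  deriv (fun ζ : ℝ => cauchyKernel (slicePt (unitVec q) ⟨q 0, ζ⟩) x) ‖vec q‖

/-- The slice Teodorescu transform
`T_{Ω_I} f(q) = -(1/2π) ∫_{Ω_I} S⁻¹(q, x) f(x) dV_I(x)`. -/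
def sliceT {m : ℕ} (Ω : Set (Para m)) (I : Vec m) (f : Para m → Cl m) (q : Para m) : Cl m :=
  -(1 / (2 * Real.pi)) •
    ∫ z in planeSet Ω I, cauchyKernel q (slicePt I z) * f (slicePt I z)

/-- The slice Cauchy-Riemann operator
`G = ∂/∂x_0 + (vec x / |vec x|²) ∑_{j=1}^m x_j ∂/∂x_j`. -/
def opG {m : ℕ} (h : Para m → Cl m) (x : Para m) : Cl m :=
  lineDeriv ℝ h x (EuclideanSpace.single 0 1) +
    (‖vec x‖ ^ 2)⁻¹ •
      (vecCl (vec x) * ∑ j : Fin m, x j.succ • lineDeriv ℝ h x (EuclideanSpace.single j.succ 1))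

/-- `α = (1 - I_q I)/2`. -/
def alpha {m : ℕ} (I : Vec m) (q : Para m) : Cl m :=
  (1 / 2 : ℝ) • (1 - vecCl (unitVec q) * vecCl I)

/-- `β = (1 + I_q I)/2`. -/
def beta {m : ℕ} (I : Vec m) (q : Para m) : Cl m :=
  (1 / 2 : ℝ) • (1 + vecCl (unitVec q) * vecCl I)

/-- `P` is the Cauchy principal value of the integral over `U` of `g`, with singularities at
`c` and at its complex conjugate. -/
def HasPV {m : ℕ} (U : Set ℂ) (c : ℂ) (g : ℂ → Cl m) (P : Cl m) : Prop :=
  (∀ ε : ℝ, 0 < ε → MeasureTheory.IntegrableOn g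
    (U \ (Metric.ball c ε ∪ Metric.ball (star c) ε))) ∧
  Filter.Tendsto
    (fun ε : ℝ => ∫ z in U \ (Metric.ball c ε ∪ Metric.ball (star c) ε), g z)
    (𝓝[>] 0) (𝓝 P)

/-- `f ∈ C¹(closure Ω)`, for an open set `Ω`: on `Ω`, `f` is differentiable, and `f` and its
derivative extend continuously to the closure of `Ω`. Only the values of `f` on `Ω` matter. -/
def IsC1Closure {m : ℕ} (Ω : Set (Para m)) (f : Para m → Cl m) : Prop :=
  ∃ (g : Para m → Cl m) (g' : Para m → Para m →L[ℝ] Cl m),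
    ContinuousOn g (closure Ω) ∧ ContinuousOn g' (closure Ω) ∧
    ∀ x ∈ Ω, f x = g x ∧ HasFDerivAt f (g' x) x

/-- `f` is a (left) slice function on `Ω_D`: there is a stem function `F = F₁ + i F₂` on `D`,
`F(conj z) = conj F(z)`, with `f(u + J v) = F₁(z) + J F₂(z)` for all unit vectors `J` and all
`z = u + i v ∈ D`. -/
def IsSlice {m : ℕ} (D : Set ℂ) (f : Para m → Cl m) : Prop :=
  ∃ F₁ F₂ : ℂ → Cl m,
    (∀ z ∈ D, F₁ (star z) = F₁ z ∧ F₂ (star z) = -F₂ z) ∧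
    ∀ J ∈ Metric.sphere (0 : Vec m) 1, ∀ z ∈ D,
      f (slicePt J z) = F₁ z + vecCl J * F₂ z

end SliceClifford

end

open SliceClifford

noncomputable section

namespace SliceClifford

open MeasureTheory Metric Complex Filter

/-! The problem reduces to the planar Cauchy transform. With `c = q₀ + iζ`, and with `ℂ` acting on
`Cl_m` by left multiplication through `ℂ_I`, the kernel on `ℂ_I` splits as `α (z - c)⁻¹ + β (z -
c̄)⁻¹` (`cauchyKernel_slicePt`). Hence `-2π T f(q) = α C(c) + β C(c̄)`, where `C(c) = ∫_D (z - c)⁻¹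
f`.

The derivative of `C` at `c₀` in the direction `w` is `w V - π w̄ f(c₀)`, where `V` is the principal
value of `∫ (z - c₀)⁻² f` (`exists_hasFDerivAt_cauchyTransform`). To see this, subtract from `f` the
constant `f(c₀)` on a small disc about `c₀`. The remainder vanishes to first order at `c₀`, so its
transform may be differentiated under the integral sign. The transform of the constant on the disc
is explicitly `-π conj(c - c₀) f(c₀)`, which gives the jump term; it adds nothing to the principal
value, because `(z - c₀)⁻²` integrates to zero over annuli about `c₀`.

The variable `q` enters only through `c` and, in `α` and `β`, through `I_q`. One chain rule along an
arbitrary curve (`exists_hasDerivAt_sliceT`) therefore yields all the derivative formulas. In `G =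
∂₀ + I_q ∂_ζ` the variation of `I_q` drops out, being tangential, and the identities `I_q α I = -α`,
`I_q β I = β` cancel the principal values and add up the jump terms. For a slice function, `α f(q_I)
+ β f(q_{-I}) = f(q)` is the representation formula. -/

/-! ### Weakly singular integrals in the plane -/

theorem locallyIntegrable_norm_rpow_neg {s : ℝ} (hs : s < 2) :
    LocallyIntegrable (fun x : ℂ => ‖x‖ ^ (-s)) := by
  refine locallyIntegrable_of_norm_le_rpow (C := 1) (α := s) (by simp) (by simpa using hs) ?_ ?_
  · refine Eventually.of_forall fun x => ?_
    rw [Real.norm_of_nonneg (by positivity), one_mul]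
  · exact (measurable_norm.pow_const _).aestronglyMeasurable

theorem integrable_indicator_ball_norm_sub_rpow_neg {s : ℝ} (hs : s < 2) (c : ℂ) (r : ℝ) :
    Integrable (fun x : ℂ => (ball (0 : ℂ) r).indicator (fun y => ‖y‖ ^ (-s)) (x - c)) := by
  refine Integrable.comp_sub_right ?_ c
  rw [integrable_indicator_iff measurableSet_ball]
  exact ((locallyIntegrable_norm_rpow_neg hs).integrableOn_isCompact
    (isCompact_closedBall 0 r)).mono_set ball_subset_closedBall

theorem integrableOn_ball_norm_sub_rpow_neg {s : ℝ} (hs : s < 2) (c : ℂ) (r : ℝ) :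
    IntegrableOn (fun x : ℂ => ‖x - c‖ ^ (-s)) (ball c r) := by
  rw [← integrable_indicator_iff measurableSet_ball]
  refine (integrable_indicator_ball_norm_sub_rpow_neg hs c r).congr (.of_forall fun x => ?_)
  simp [Set.indicator, mem_ball, dist_eq_norm]

theorem setIntegral_ball_norm_sub_rpow_neg (s : ℝ) (c : ℂ) (r : ℝ) :
    ∫ x in ball c r, ‖x - c‖ ^ (-s) = ∫ x in ball (0 : ℂ) r, ‖x‖ ^ (-s) := by
  rw [← integral_indicator measurableSet_ball, ← integral_indicator measurableSet_ball,
    ← integral_sub_right_eq_self ((ball (0 : ℂ) r).indicator fun y => ‖y‖ ^ (-s)) c]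
  refine integral_congr_ae (.of_forall fun x => ?_)
  simp [Set.indicator, mem_ball, dist_eq_norm]

theorem integrableOn_norm_sub_rpow_neg {D : Set ℂ} (hD : Bornology.IsBounded D) {s : ℝ}
    (hs : s < 2) (c : ℂ) : IntegrableOn (fun x : ℂ => ‖x - c‖ ^ (-s)) D := by
  obtain ⟨r, hr⟩ := hD.subset_ball c
  exact (integrableOn_ball_norm_sub_rpow_neg hs c r).mono_set hr

theorem integrableOn_norm_sub_inv {D : Set ℂ} (hD : Bornology.IsBounded D) (c : ℂ) :
    IntegrableOn (fun x : ℂ => ‖x - c‖⁻¹) D := by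
  simpa [Real.rpow_neg_one] using integrableOn_norm_sub_rpow_neg hD one_lt_two c

/-- Uniformity in `c` is the point: the Taylor remainder of the Cauchy kernel is also singular at
the moving pole `c`. A disc of fixed radius about `c` covers `D`, and the integral over it does not
depend on `c`. -/
theorem exists_setIntegral_norm_sub_rpow_neg_le {D : Set ℂ} (hD : Bornology.IsBounded D) {s : ℝ}
    (hs : s < 2) (c₀ : ℂ) :
    ∃ C, ∀ c ∈ ball c₀ 1, ∫ x in D, ‖x - c‖ ^ (-s) ≤ C := by
  obtain ⟨r, hr⟩ := hD.subset_ball c₀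
  refine ⟨∫ x in ball (0 : ℂ) (r + 1), ‖x‖ ^ (-s), fun c hc => ?_⟩
  rw [← setIntegral_ball_norm_sub_rpow_neg s c (r + 1)]
  refine setIntegral_mono_set (integrableOn_ball_norm_sub_rpow_neg hs c _)
    (.of_forall fun x => by positivity) (Filter.Eventually.of_forall ?_)
  intro x hx
  have h1 := hr hx
  rw [mem_ball] at *
  change dist x c < r + 1
  calc dist x c ≤ dist x c₀ + dist c c₀ := dist_triangle_right _ _ _
    _ < r + 1 := by linarith

/-- This separates the poles in the Taylor remainder. The exponent `3/2` exceeds 1, so the error is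
`o(d)`, and is below 2, so the singularities stay integrable. In terms of square roots `s, t, u` the
claim reduces to `u s t ≤ (s + t) s t ≤ s³ + t³`. -/
theorem sq_div_mul_le_rpow {a b d : ℝ} (ha : 0 < a) (hb : 0 < b) (hd : 0 ≤ d) (h : d ≤ a + b) :
    d ^ 2 / (a * b) ≤ d ^ (3 / 2 : ℝ) * (a ^ (-(3 / 2) : ℝ) + b ^ (-(3 / 2) : ℝ)) := by
  have key : ∀ x : ℝ, 0 ≤ x → x ^ (3 / 2 : ℝ) = √x ^ 3 := by
    intro x hx
    rw [Real.sqrt_eq_rpow, ← Real.rpow_natCast, ← Real.rpow_mul hx]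
    norm_num
  rw [Real.rpow_neg ha.le, Real.rpow_neg hb.le, key a ha.le, key b hb.le, key d hd]
  have hs : 0 < √a := Real.sqrt_pos.2 ha
  have ht : 0 < √b := Real.sqrt_pos.2 hb
  have hu : 0 ≤ √d := Real.sqrt_nonneg d
  have ea : √a ^ 2 = a := Real.sq_sqrt ha.le
  have eb : √b ^ 2 = b := Real.sq_sqrt hb.le
  have ed : √d ^ 2 = d := Real.sq_sqrt hd
  set s := √a
  set t := √b
  set u := √d
  rw [← ea, ← eb, ← ed] at h ⊢
  have hust : u ≤ s + t := by
    refine abs_le_of_sq_le_sq' (a := u) ?_ (by positivity) |>.2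
    nlinarith [mul_pos hs ht]
  have h3 : s * t * (s + t) ≤ s ^ 3 + t ^ 3 := by nlinarith [mul_nonneg (add_pos hs ht).le (sq_nonneg (s - t))]
  have h4 : u * (s * t) ≤ s ^ 3 + t ^ 3 := by nlinarith [mul_pos hs ht]
  have e : u ^ 3 * ((s ^ 3)⁻¹ + (t ^ 3)⁻¹) = u ^ 3 * (s ^ 3 + t ^ 3) / (s ^ 3 * t ^ 3) := by
    field_simp
    ring
  rw [e, div_le_div_iff₀ (by positivity) (by positivity)]
  have h5 : 0 ≤ u ^ 3 * (s ^ 2 * t ^ 2) := by positivity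
  nlinarith [mul_le_mul_of_nonneg_left h4 h5]

theorem inv_sub_taylor {x c c₀ : ℂ} (h : x ≠ c) (h₀ : x ≠ c₀) :
    (x - c)⁻¹ - (x - c₀)⁻¹ - (c - c₀) * ((x - c₀) ^ 2)⁻¹ =
      (c - c₀) ^ 2 * ((x - c)⁻¹ * ((x - c₀) ^ 2)⁻¹) := by
  have h1 : x - c ≠ 0 := sub_ne_zero.2 h
  have h2 : x - c₀ ≠ 0 := sub_ne_zero.2 h₀
  field_simp
  ring

/-! ### The Cauchy transform of a density vanishing at the pole -/

section

variable {E : Type*} [NormedAddCommGroup E] [NormedSpace ℝ E]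

theorem aestronglyMeasurable_bilin_kernel (B : ℂ →L[ℝ] E →L[ℝ] E) {μ : Measure ℂ} {k : ℂ → ℂ}
    (hk : Measurable k) {h : ℂ → E} (hh : AEStronglyMeasurable h μ) :
    AEStronglyMeasurable (fun x => B (k x) (h x)) μ :=
  B.isBoundedBilinearMap.continuous.comp_aestronglyMeasurable
    (hk.aestronglyMeasurable.prodMk hh)

theorem integrableOn_bilin_inv_sub (B : ℂ →L[ℝ] E →L[ℝ] E) {D : Set ℂ}
    (hD : Bornology.IsBounded D) (hDm : MeasurableSet D) {h : ℂ → E}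
    (hh : AEStronglyMeasurable h (volume.restrict D)) {M : ℝ} (hM : ∀ x ∈ D, ‖h x‖ ≤ M) (c : ℂ) :
    IntegrableOn (fun x => B ((x - c)⁻¹) (h x)) D := by
  refine Integrable.mono' ((integrableOn_norm_sub_inv hD c).const_mul (‖B‖ * M))
    (aestronglyMeasurable_bilin_kernel B (by fun_prop) hh) ?_
  refine (ae_restrict_iff' hDm).2 (.of_forall fun x hx => ?_)
  calc ‖B ((x - c)⁻¹) (h x)‖ ≤ ‖B‖ * ‖(x - c)⁻¹‖ * ‖h x‖ := B.le_opNorm₂ _ _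
    _ ≤ ‖B‖ * ‖(x - c)⁻¹‖ * M := by gcongr; exact hM x hx
    _ = ‖B‖ * M * ‖x - c‖⁻¹ := by rw [norm_inv]; ring

theorem integrableOn_bilin_inv_sub_sq (B : ℂ →L[ℝ] E →L[ℝ] E) {D : Set ℂ}
    (hD : Bornology.IsBounded D) (hDm : MeasurableSet D) {h : ℂ → E}
    (hh : AEStronglyMeasurable h (volume.restrict D)) {c₀ : ℂ} {l : ℝ}
    (hl : ∀ x ∈ D, ‖h x‖ ≤ l * ‖x - c₀‖) :
    IntegrableOn (fun x => B (((x - c₀) ^ 2)⁻¹) (h x)) D := by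
  refine Integrable.mono' ((integrableOn_norm_sub_inv hD c₀).const_mul (‖B‖ * l))
    (aestronglyMeasurable_bilin_kernel B (by fun_prop) hh) ?_
  refine (ae_restrict_iff' hDm).2 (.of_forall fun x hx => ?_)
  calc ‖B (((x - c₀) ^ 2)⁻¹) (h x)‖ ≤ ‖B‖ * ‖((x - c₀) ^ 2)⁻¹‖ * ‖h x‖ := B.le_opNorm₂ _ _
    _ ≤ ‖B‖ * ‖((x - c₀) ^ 2)⁻¹‖ * (l * ‖x - c₀‖) := by gcongr; exact hl x hx
    _ = ‖B‖ * l * ‖x - c₀‖⁻¹ := by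
      rw [norm_inv, norm_pow]
      rcases eq_or_ne (‖x - c₀‖) 0 with h0 | h0
      · simp [h0]
      · field_simp

variable [CompleteSpace E]

/-- The Cauchy transform of a density which vanishes to first order at `c₀` is differentiable
at `c₀`, and may be differentiated under the integral sign. -/
theorem hasFDerivAt_cauchyTransform_of_le (B : ℂ →L[ℝ] E →L[ℝ] E)
    (hB : ∀ a b y, B (a * b) y = B a (B b y)) {D : Set ℂ}
    (hD : Bornology.IsBounded D) (hDm : MeasurableSet D) {h : ℂ → E}
    (hh : AEStronglyMeasurable h (volume.restrict D)) {M : ℝ} (hM : ∀ x ∈ D, ‖h x‖ ≤ M)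
    {c₀ : ℂ} {l : ℝ} (hl0 : 0 ≤ l) (hl : ∀ x ∈ D, ‖h x‖ ≤ l * ‖x - c₀‖) :
    HasFDerivAt (fun c => ∫ x in D, B ((x - c)⁻¹) (h x))
      (B.flip (∫ x in D, B (((x - c₀) ^ 2)⁻¹) (h x))) c₀ := by
  obtain ⟨C, hC⟩ := exists_setIntegral_norm_sub_rpow_neg_le hD (s := 3 / 2) (by norm_num) c₀
  have hbound : ∀ c ∈ ball c₀ 1, ‖(∫ x in D, B ((x - c)⁻¹) (h x)) -
      (∫ x in D, B ((x - c₀)⁻¹) (h x)) -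
      B.flip (∫ x in D, B (((x - c₀) ^ 2)⁻¹) (h x)) (c - c₀)‖ ≤
        ‖B‖ * l * (C + C) * ‖c - c₀‖ ^ (3 / 2 : ℝ) := by
    intro c hc
    have i1 := integrableOn_bilin_inv_sub B hD hDm hh hM c
    have i2 := integrableOn_bilin_inv_sub B hD hDm hh hM c₀
    have i3 := integrableOn_bilin_inv_sub_sq B hD hDm hh hl
    have i4 := integrableOn_norm_sub_rpow_neg hD (s := 3 / 2) (by norm_num) c
    have i5 := integrableOn_norm_sub_rpow_neg hD (s := 3 / 2) (by norm_num) c₀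
    -- The three terms merge into one integral, whose integrand is the exact remainder given by
    -- `inv_sub_taylor`.
    rw [ContinuousLinearMap.flip_apply, ← ContinuousLinearMap.integral_comp_comm _ i3,
      ← integral_sub i1 i2]
    have i6 := integral_sub (i1.sub i2) ((B (c - c₀)).integrable_comp i3)
    simp only [Pi.sub_apply] at i6
    rw [← i6]
    calc _ ≤ ∫ x in D, ‖B‖ * l * ‖c - c₀‖ ^ (3 / 2 : ℝ) *
          (‖x - c‖ ^ (-(3 / 2) : ℝ) + ‖x - c₀‖ ^ (-(3 / 2) : ℝ)) := by
          refine norm_integral_le_of_norm_le ((i4.add i5).const_mul _) ?_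
          have hne : ∀ a : ℂ, ∀ᵐ x ∂(volume.restrict D), x ≠ a := fun a =>
            ae_restrict_of_ae (Measure.ae_ne volume a)
          filter_upwards [hne c, hne c₀, ae_restrict_mem hDm] with x h1 h2 hx
          have e : B ((x - c)⁻¹) (h x) - B ((x - c₀)⁻¹) (h x) -
              B (c - c₀) (B (((x - c₀) ^ 2)⁻¹) (h x)) =
              B ((c - c₀) ^ 2 * ((x - c)⁻¹ * ((x - c₀) ^ 2)⁻¹)) (h x) := by
            rw [← hB, ← inv_sub_taylor h1 h2, map_sub, map_sub]
            rfl
          rw [e]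
          have p1 : 0 < ‖x - c‖ := norm_pos_iff.2 (sub_ne_zero.2 h1)
          have p2 : 0 < ‖x - c₀‖ := norm_pos_iff.2 (sub_ne_zero.2 h2)
          have htri : ‖c - c₀‖ ≤ ‖x - c‖ + ‖x - c₀‖ := by
            rw [← dist_eq_norm, ← dist_eq_norm, ← dist_eq_norm, dist_comm x c]
            exact dist_triangle _ _ _
          calc _ ≤ ‖B‖ * ‖(c - c₀) ^ 2 * ((x - c)⁻¹ * ((x - c₀) ^ 2)⁻¹)‖ * ‖h x‖ :=
                B.le_opNorm₂ _ _
            _ ≤ ‖B‖ * ‖(c - c₀) ^ 2 * ((x - c)⁻¹ * ((x - c₀) ^ 2)⁻¹)‖ * (l * ‖x - c₀‖) := by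
                gcongr
                exact hl x hx
            -- The zero of `h` at `c₀` has cancelled one of the two factors `‖x - c₀‖⁻¹`.
            _ = ‖B‖ * l * (‖c - c₀‖ ^ 2 / (‖x - c‖ * ‖x - c₀‖)) := by
                rw [norm_mul, norm_mul, norm_pow, norm_inv, norm_inv, norm_pow]
                field_simp
            _ ≤ ‖B‖ * l * (‖c - c₀‖ ^ (3 / 2 : ℝ) *
                (‖x - c‖ ^ (-(3 / 2) : ℝ) + ‖x - c₀‖ ^ (-(3 / 2) : ℝ))) := by
                gcongr
                exact sq_div_mul_le_rpow p1 p2 (norm_nonneg _) htri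
            _ = _ := by ring
      _ = ‖B‖ * l * ‖c - c₀‖ ^ (3 / 2 : ℝ) * ((∫ x in D, ‖x - c‖ ^ (-(3 / 2) : ℝ)) +
            ∫ x in D, ‖x - c₀‖ ^ (-(3 / 2) : ℝ)) := by
          rw [integral_const_mul, integral_add i4 i5]
      _ ≤ ‖B‖ * l * ‖c - c₀‖ ^ (3 / 2 : ℝ) * (C + C) := by
          gcongr
          · exact hC c hc
          · exact hC c₀ (mem_ball_self one_pos)
      _ = _ := by ring
  rw [hasFDerivAt_iff_isLittleO]
  have hO : (fun c => (∫ x in D, B ((x - c)⁻¹) (h x)) -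
      (∫ x in D, B ((x - c₀)⁻¹) (h x)) -
      B.flip (∫ x in D, B (((x - c₀) ^ 2)⁻¹) (h x)) (c - c₀)) =O[𝓝 c₀]
        fun c => ‖c - c₀‖ ^ (3 / 2 : ℝ) := by
    refine Asymptotics.IsBigO.of_bound (‖B‖ * l * (C + C)) ?_
    filter_upwards [ball_mem_nhds c₀ one_pos] with c hc
    rw [Real.norm_of_nonneg (by positivity)]
    exact hbound c hc
  refine hO.trans_isLittleO ?_
  have h1 : (fun c => ‖c - c₀‖ ^ (3 / 2 : ℝ)) = fun c => ‖c - c₀‖ ^ (1 / 2 : ℝ) * ‖c - c₀‖ := by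
    funext c
    rcases (norm_nonneg (c - c₀)).eq_or_lt with h0 | h0
    · rw [← h0]; norm_num
    · nth_rewrite 3 [← Real.rpow_one ‖c - c₀‖]
      rw [← Real.rpow_add h0]
      norm_num
  rw [h1, ← Asymptotics.isLittleO_norm_right]
  have h2 : (fun c => ‖c - c₀‖ ^ (1 / 2 : ℝ)) =o[𝓝 c₀] fun _ => (1 : ℝ) := by
    rw [Asymptotics.isLittleO_one_iff]
    have : ContinuousAt (fun c => ‖c - c₀‖ ^ (1 / 2 : ℝ)) c₀ :=
      (by fun_prop : ContinuousAt (fun c => ‖c - c₀‖) c₀).rpow_const (Or.inr (by norm_num))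
    simpa [ContinuousAt] using this
  simpa using h2.mul_isBigO (Asymptotics.isBigO_refl (fun c => ‖c - c₀‖) (𝓝 c₀))

end

/-! ### Explicit integrals over discs and annuli -/

theorem integrableOn_comp_polarCoord_symm {F : Type*} [NormedAddCommGroup F] [NormedSpace ℝ F]
    {f : ℂ → F} (hf : Integrable f) :
    IntegrableOn (fun p => p.1 • f (Complex.polarCoord.symm p)) polarCoord.target := by
  have hg : Integrable (fun p => f (measurableEquivRealProd.symm p)) :=
    (Complex.volume_preserving_equiv_real_prod.symm.integrable_comp_emb
      measurableEquivRealProd.symm.measurableEmbedding).2 hf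
  have h1 : IntegrableOn (fun p => f (measurableEquivRealProd.symm p))
      (_root_.polarCoord.symm '' _root_.polarCoord.target) := hg.integrableOn
  rw [integrableOn_image_iff_integrableOn_abs_det_fderiv_smul volume
    _root_.polarCoord.open_target.measurableSet
    (fun p _ => (hasFDerivAt_polarCoord_symm p).hasFDerivWithinAt)
    _root_.polarCoord.symm.injOn] at h1
  refine h1.congr_fun (fun p hp => ?_) _root_.polarCoord.open_target.measurableSet
  simp only [det_fderivPolarCoordSymm]
  rw [abs_of_pos hp.1, measurableEquivRealProd_symm_polarCoord_symm_apply]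

theorem integral_eq_integral_circleAverage {F : Type*} [NormedAddCommGroup F] [NormedSpace ℝ F]
    [CompleteSpace F] {f : ℂ → F} (hf : Integrable f) :
    ∫ z, f z = ∫ r in Set.Ioi (0 : ℝ), (2 * Real.pi * r) • Real.circleAverage f 0 r := by
  rw [← Complex.integral_comp_polarCoord_symm]
  have h := integrableOn_comp_polarCoord_symm hf
  have ht : polarCoord.target = Set.Ioi (0 : ℝ) ×ˢ Set.Ioo (-Real.pi) Real.pi := rfl
  rw [ht] at h ⊢
  rw [Measure.volume_eq_prod] at h ⊢
  rw [setIntegral_prod _ h]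
  refine setIntegral_congr_fun measurableSet_Ioi fun r hr => ?_
  have hper : Function.Periodic (fun θ => f (circleMap 0 r θ)) (2 * Real.pi) := fun θ => by
    simp only [periodic_circleMap 0 r θ]
  have h2 := hper.intervalIntegral_add_eq 0 (-Real.pi)
  have e1 : -Real.pi + 2 * Real.pi = Real.pi := by ring
  rw [e1, zero_add] at h2
  simp only
  rw [Real.circleAverage_def, h2, intervalIntegral.integral_of_le (by linarith [Real.pi_pos]),
    integral_Ioc_eq_integral_Ioo, smul_smul, integral_smul]
  congr 1
  · field_simp
  · refine integral_congr_ae (.of_forall fun θ => ?_)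
    simp [circleMap, Complex.exp_mul_I]

theorem circleAverage_inv_sub_of_lt_norm {w : ℂ} {r : ℝ} (hr : 0 < r) (h : r < ‖w‖) :
    Real.circleAverage (fun z => (z - w)⁻¹) 0 r = -w⁻¹ := by
  have hd : DiffContOnCl ℂ (fun z : ℂ => (z - w)⁻¹) (ball 0 |r|) := by
    refine DifferentiableOn.diffContOnCl ?_
    refine ((differentiable_id.sub_const w).differentiableOn).inv fun z hz => ?_
    rw [abs_of_pos hr, closure_ball _ hr.ne', mem_closedBall_zero_iff] at hz
    intro h0
    have h1 : z = w := sub_eq_zero.1 h0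
    rw [h1] at hz
    exact absurd hz (not_le.2 h)
  rw [hd.circleAverage, zero_sub, inv_neg]

/-- Write `(z - w)⁻¹ = w⁻¹ (z / (z - w) - 1)`; by Cauchy's formula the average of `z / (z - w)` is
1. -/
theorem circleAverage_inv_sub_of_norm_lt {w : ℂ} (hw : w ≠ 0) {r : ℝ} (h : ‖w‖ < r) :
    Real.circleAverage (fun z => (z - w)⁻¹) 0 r = 0 := by
  have hr : 0 < r := (norm_nonneg _).trans_lt h
  have h1 : Real.circleAverage (fun z : ℂ => ((z - 0) / (z - w)) • (1 : ℂ)) 0 r = 1 :=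
    DiffContOnCl.circleAverage_smul_div diffContOnCl_const
      (by rwa [abs_of_pos hr, mem_ball_zero_iff])
  have hne : ∀ z ∈ sphere (0 : ℂ) |r|, z - w ≠ 0 := by
    intro z hz h0
    rw [abs_of_pos hr, mem_sphere_zero_iff_norm, sub_eq_zero.1 h0] at hz
    exact h.ne hz
  have e : Real.circleAverage (fun z => (z - w)⁻¹) 0 r =
      Real.circleAverage (w⁻¹ • ((fun z : ℂ => ((z - 0) / (z - w)) • (1 : ℂ)) - fun _ => 1)) 0 r := by
    refine Real.circleAverage_congr_sphere fun z hz => ?_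
    have := hne z hz
    simp only [Pi.smul_apply, Pi.sub_apply, smul_eq_mul]
    field_simp
    ring
  rw [e, Real.circleAverage_smul, Real.circleAverage_sub, h1, Real.circleAverage_const, sub_self,
    smul_zero]
  · refine ContinuousOn.circleIntegrable' ?_
    refine ContinuousOn.smul (ContinuousOn.div (by fun_prop) (by fun_prop) hne) (by fun_prop)
  · exact circleIntegrable_const _ _ _

/-- Only circles of radius `r < ‖w‖` contribute, each with density `-2πr w⁻¹`; the total is `-π ‖w‖²
w⁻¹ = -π w̄`. For `w = 0` the integrand is odd. -/
theorem setIntegral_ball_zero_inv_sub {R : ℝ} {w : ℂ} (h : ‖w‖ < R) :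
    ∫ x in ball (0 : ℂ) R, (x - w)⁻¹ = -Real.pi * (starRingEnd ℂ) w := by
  rcases eq_or_ne w 0 with rfl | hw
  · have h1 := (integral_neg_eq_self
      ((ball (0 : ℂ) R).indicator fun x : ℂ => (x - 0)⁻¹) volume).symm
    have h2 : ∀ x : ℂ, ((ball (0 : ℂ) R).indicator fun x : ℂ => (x - 0)⁻¹) (-x) =
        -((ball (0 : ℂ) R).indicator fun x : ℂ => (x - 0)⁻¹) x := by
      intro x
      by_cases hx : ‖x‖ < R <;> simp [Set.indicator, hx, inv_neg]
    simp only [h2] at h1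
    rw [integral_neg, integral_indicator measurableSet_ball, self_eq_neg] at h1
    rw [h1]
    simp
  have hint : Integrable ((ball (0 : ℂ) R).indicator fun x => (x - w)⁻¹) := by
    rw [integrable_indicator_iff measurableSet_ball]
    refine ((integrableOn_norm_sub_inv isBounded_ball w).mono' (by fun_prop) ?_)
    exact .of_forall fun x => by rw [norm_inv]
  rw [← integral_indicator measurableSet_ball, integral_eq_integral_circleAverage hint]
  have hw0 : 0 < ‖w‖ := norm_pos_iff.2 hw
  have e : ∀ᵐ r : ℝ ∂volume.restrict (Set.Ioi 0), (2 * Real.pi * r) •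
      Real.circleAverage ((ball (0 : ℂ) R).indicator fun x => (x - w)⁻¹) 0 r =
      (Set.Ioo 0 ‖w‖).indicator (fun r : ℝ => (r : ℂ) * (-2 * Real.pi * w⁻¹)) r := by
    filter_upwards [ae_restrict_mem measurableSet_Ioi,
      ae_restrict_of_ae (Measure.ae_ne volume ‖w‖)] with r (hr : 0 < r) hrw
    rcases lt_or_ge r R with hrR | hrR
    · have e1 : Real.circleAverage ((ball (0 : ℂ) R).indicator fun x => (x - w)⁻¹) 0 r =
          Real.circleAverage (fun x => (x - w)⁻¹) 0 r := by
        refine Real.circleAverage_congr_sphere fun z hz => ?_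
        rw [abs_of_pos hr, mem_sphere_zero_iff_norm] at hz
        simp [Set.indicator, hz, hrR]
      rw [e1]
      rcases lt_or_gt_of_ne hrw with h1 | h1
      · rw [circleAverage_inv_sub_of_lt_norm hr h1, Set.indicator_of_mem (Set.mem_Ioo.2 ⟨hr, h1⟩)]
        rw [Complex.real_smul]
        push_cast
        ring
      · rw [circleAverage_inv_sub_of_norm_lt hw h1, Set.indicator_of_notMem, smul_zero]
        exact fun h2 => absurd h2.2 (not_lt.2 h1.le)
    · have e1 : Real.circleAverage ((ball (0 : ℂ) R).indicator fun x => (x - w)⁻¹) 0 r =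
          Real.circleAverage (fun _ => 0) 0 r := by
        refine Real.circleAverage_congr_sphere fun z hz => ?_
        rw [abs_of_pos hr, mem_sphere_zero_iff_norm] at hz
        simp [Set.indicator, hz, hrR]
      rw [e1, Real.circleAverage_const, smul_zero, Set.indicator_of_notMem]
      exact fun h2 => absurd h2.2 (not_lt.2 (h.le.trans hrR))
  rw [integral_congr_ae e, integral_indicator measurableSet_Ioo,
    Measure.restrict_restrict measurableSet_Ioo,
    Set.inter_eq_left.2 (Set.Ioo_subset_Ioi_self : Set.Ioo 0 ‖w‖ ⊆ Set.Ioi 0),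
    ← integral_Ioc_eq_integral_Ioo, ← intervalIntegral.integral_of_le hw0.le,
    intervalIntegral.integral_mul_const, intervalIntegral.integral_ofReal, integral_id]
  have e2 : ((‖w‖ : ℂ)) ^ 2 = w * (starRingEnd ℂ) w := by
    rw [Complex.mul_conj, Complex.normSq_eq_norm_sq]; push_cast; rfl
  push_cast
  rw [e2]
  field_simp
  ring

theorem setIntegral_ball_inv_sub {R : ℝ} {c₀ c : ℂ} (h : c ∈ ball c₀ R) :
    ∫ x in ball c₀ R, (x - c)⁻¹ = -Real.pi * (starRingEnd ℂ) (c - c₀) := by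
  rw [mem_ball, dist_eq_norm] at h
  rw [← setIntegral_ball_zero_inv_sub h, ← integral_indicator measurableSet_ball,
    ← integral_indicator measurableSet_ball,
    ← integral_add_right_eq_self _ c₀]
  refine integral_congr_ae (.of_forall fun x => ?_)
  simp [Set.indicator, mem_ball, dist_eq_norm, sub_sub_eq_add_sub]

/-- The integral of `(x - c)⁻²` over an annulus centred at `c` vanishes. -/
theorem setIntegral_annulus_inv_sq (c : ℂ) (ε R : ℝ) :
    ∫ x in ball c R \ ball c ε, ((x - c) ^ 2)⁻¹ = 0 := by
  -- Rotation by a right angle preserves the annulus and the measure but changes the sign of `x⁻²`.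
  obtain ⟨u, hu⟩ : ∃ u : Circle, (u : ℂ) = I := ⟨⟨I, by simp [Submonoid.unitSphere]⟩, rfl⟩
  set g : ℂ → ℂ := (ball (0 : ℂ) R \ ball 0 ε).indicator fun x => (x ^ 2)⁻¹ with hg
  have hm : MeasurableSet (ball (0 : ℂ) R \ ball 0 ε) := measurableSet_ball.diff measurableSet_ball
  have e1 : ∫ x in ball c R \ ball c ε, ((x - c) ^ 2)⁻¹ = ∫ x, g x := by
    rw [← integral_indicator (measurableSet_ball.diff measurableSet_ball),
      ← integral_sub_right_eq_self g c]
    refine integral_congr_ae (.of_forall fun x => ?_)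
    simp [hg, Set.indicator, mem_ball, dist_eq_norm]
  have e2 : ∫ x, g x = ∫ x, g (rotation u x) :=
    ((rotation _).measurePreserving.integral_comp
      (rotation _).toHomeomorph.measurableEmbedding g).symm
  have e3 : ∀ x, g (rotation u x) = -g x := by
    intro x
    simp only [hg, Set.indicator, rotation_apply, Set.mem_sdiff, mem_ball_zero_iff, norm_mul,
      mul_pow, one_mul, hu, norm_I, I_sq]
    split_ifs <;> simp
  simp only [e3] at e2
  rw [integral_neg, self_eq_neg] at e2
  rw [e1, e2]

/-! ### Principal values and the derivative of the Cauchy transform -/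

theorem tendsto_setIntegral_sdiff_balls {F : Type*} [NormedAddCommGroup F] [NormedSpace ℝ F]
    {D : Set ℂ} {g : ℂ → F} (hg : IntegrableOn g D) (c₀ c₁ : ℂ) :
    Tendsto (fun ε : ℝ => ∫ z in D \ (ball c₀ ε ∪ ball c₁ ε), g z) (𝓝[>] 0)
      (𝓝 (∫ z in D, g z)) := by
  have hm : ∀ ε : ℝ, MeasurableSet (ball c₀ ε ∪ ball c₁ ε)ᶜ := fun ε =>
    (measurableSet_ball.union measurableSet_ball).compl
  have e : ∀ ε : ℝ, ∫ z in D \ (ball c₀ ε ∪ ball c₁ ε), g z =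
      ∫ z in D, ((ball c₀ ε ∪ ball c₁ ε)ᶜ).indicator g z := by
    intro ε
    rw [setIntegral_indicator (hm ε), Set.sdiff_eq]
  simp only [e]
  refine tendsto_integral_filter_of_dominated_convergence (fun z => ‖g z‖) ?_ ?_ hg.norm ?_
  · exact .of_forall fun ε => hg.aestronglyMeasurable.indicator (hm ε)
  · exact .of_forall fun ε => .of_forall fun z => norm_indicator_le_norm_self _ _
  · filter_upwards [ae_restrict_of_ae (Measure.ae_ne volume c₀),
      ae_restrict_of_ae (Measure.ae_ne volume c₁)] with z h0 h1
    refine tendsto_const_nhds.congr' ?_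
    have h2 : 0 < min (dist z c₀) (dist z c₁) := lt_min (dist_pos.2 h0) (dist_pos.2 h1)
    filter_upwards [Ioo_mem_nhdsGT h2] with ε hε
    rw [Set.indicator_of_mem]
    simp only [Set.mem_compl_iff, Set.mem_union, mem_ball, not_or, not_lt]
    exact ⟨(hε.2.trans_le (min_le_left _ _)).le, (hε.2.trans_le (min_le_right _ _)).le⟩

section

variable {E : Type*} [NormedAddCommGroup E] [NormedSpace ℝ E]

theorem integrableOn_bilin_inv_sub_sq_sdiff (B : ℂ →L[ℝ] E →L[ℝ] E) {D : Set ℂ}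
    (hD : Bornology.IsBounded D) (hDm : MeasurableSet D) {h : ℂ → E}
    (hh : AEStronglyMeasurable h (volume.restrict D)) {M : ℝ} (hM : ∀ x ∈ D, ‖h x‖ ≤ M)
    (c₀ c₁ : ℂ) {ε : ℝ} (hε : 0 < ε) :
    IntegrableOn (fun x => B (((x - c₀) ^ 2)⁻¹) (h x)) (D \ (ball c₀ ε ∪ ball c₁ ε)) := by
  have hm : MeasurableSet (D \ (ball c₀ ε ∪ ball c₁ ε)) :=
    hDm.diff (measurableSet_ball.union measurableSet_ball)
  have hfin : volume (D \ (ball c₀ ε ∪ ball c₁ ε)) < ⊤ :=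
    (hD.subset Set.sdiff_subset).measure_lt_top
  refine IntegrableOn.of_bound hfin
    (aestronglyMeasurable_bilin_kernel B (by fun_prop) (hh.mono_set Set.sdiff_subset))
    (‖B‖ * (ε ^ 2)⁻¹ * M) ?_
  refine (ae_restrict_iff' hm).2 (.of_forall fun x hx => ?_)
  have h1 : ε ≤ ‖x - c₀‖ := by
    rw [← dist_eq_norm]
    exact not_lt.1 fun h => hx.2 (Or.inl h)
  calc ‖B (((x - c₀) ^ 2)⁻¹) (h x)‖ ≤ ‖B‖ * ‖((x - c₀) ^ 2)⁻¹‖ * ‖h x‖ := B.le_opNorm₂ _ _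
    _ ≤ ‖B‖ * (ε ^ 2)⁻¹ * M := by
      rw [norm_inv, norm_pow]
      gcongr
      exact hM x hx.1

/-- The derivative of the Cauchy transform `c ↦ ∫_D (x - c)⁻¹ f(x) dx`. It consists of a principal
value integral and of a jump term. -/
theorem exists_hasFDerivAt_cauchyTransform [CompleteSpace E] (B : ℂ →L[ℝ] E →L[ℝ] E)
    (hB : ∀ a b y, B (a * b) y = B a (B b y)) {D : Set ℂ} (hDo : IsOpen D)
    (hD : Bornology.IsBounded D) {f : ℂ → E} (hf : ContinuousOn f D) {M : ℝ}
    (hM : ∀ x ∈ D, ‖f x‖ ≤ M) {c₀ c₁ : ℂ} (hc₀ : c₀ ∈ D) (hne : c₁ ≠ c₀)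
    (hdiff : DifferentiableAt ℝ f c₀) :
    ∃ V : E, HasFDerivAt (fun c => ∫ x in D, B ((x - c)⁻¹) (f x))
        (B.flip V - Real.pi • (B.flip (f c₀)).comp (conjCLE : ℂ →L[ℝ] ℂ)) c₀ ∧
      Tendsto (fun ε : ℝ => ∫ x in D \ (ball c₀ ε ∪ ball c₁ ε), B (((x - c₀) ^ 2)⁻¹) (f x))
        (𝓝[>] 0) (𝓝 V) := by
  have hDm := hDo.measurableSet
  obtain ⟨l, hlpos, hl⟩ := hdiff.hasFDerivAt.isBigO_sub.exists_pos
  rw [Asymptotics.isBigOWith_iff] at hl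
  have hdist : 0 < dist c₁ c₀ := dist_pos.2 hne
  -- Half the distance to `c₁` keeps the disc clear of every hole about `c₁` of radius below that
  -- half.
  obtain ⟨R, hR, hRl⟩ : ∃ R > 0, ∀ x ∈ ball c₀ R,
      (‖f x - f c₀‖ ≤ l * ‖x - c₀‖ ∧ x ∈ D) ∧ dist x c₀ < dist c₁ c₀ / 2 := by
    have := (hl.and (hDo.mem_nhds hc₀)).and (ball_mem_nhds c₀ (half_pos hdist))
    exact Metric.eventually_nhds_iff_ball.1 this
  have hM0 : 0 ≤ M := (norm_nonneg _).trans (hM c₀ hc₀)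
  have hsub : ball c₀ R ⊆ D := fun x hx => (hRl x hx).1.2
  set g : ℂ → E := (ball c₀ R).indicator fun _ => f c₀ with hg
  set h : ℂ → E := fun x => f x - g x with hh
  have hfm : AEStronglyMeasurable f (volume.restrict D) := hf.aestronglyMeasurable hDm
  have hgm : AEStronglyMeasurable g (volume.restrict D) :=
    aestronglyMeasurable_const.indicator measurableSet_ball
  have hhm : AEStronglyMeasurable h (volume.restrict D) := hfm.sub hgm
  have hgb : ∀ x ∈ D, ‖g x‖ ≤ M := fun x _ =>
    (norm_indicator_le_norm_self _ _).trans (hM c₀ hc₀)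
  have hhb : ∀ x ∈ D, ‖h x‖ ≤ M + M := fun x hx =>
    (norm_sub_le _ _).trans (add_le_add (hM x hx) (hgb x hx))
  -- Inside the disc differentiability gives the slope `l`; outside it `M ≤ (M / R) ‖x - c₀‖`.
  have hhl : ∀ x ∈ D, ‖h x‖ ≤ (l + M / R) * ‖x - c₀‖ := by
    intro x hx
    by_cases hxb : x ∈ ball c₀ R
    · have e : h x = f x - f c₀ := by rw [hh, hg]; simp only [Set.indicator_of_mem hxb]
      rw [e]
      refine (hRl x hxb).1.1.trans ?_
      gcongr
      exact le_add_of_nonneg_right (by positivity)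
    · have e : h x = f x := by rw [hh, hg]; simp only [Set.indicator_of_notMem hxb, sub_zero]
      rw [e]
      have h1 : R ≤ ‖x - c₀‖ := by
        rw [← dist_eq_norm]
        exact not_lt.1 hxb
      calc ‖f x‖ ≤ M := hM x hx
        _ = M / R * R := by field_simp
        _ ≤ (l + M / R) * ‖x - c₀‖ := by
          gcongr
          exact le_add_of_nonneg_left hlpos.le
  have hBg : ∀ (k : ℂ) (x : ℂ), B k (g x) =
      (ball c₀ R).indicator (fun _ => B k (f c₀)) x := by
    intro k x
    by_cases hxb : x ∈ ball c₀ R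
    · rw [hg]; simp only [Set.indicator_of_mem hxb]
    · rw [hg]; simp only [Set.indicator_of_notMem hxb, map_zero]
  have hind : ∀ (k : ℂ → ℂ) (x : ℂ), B (k x) (g x) =
      (ball c₀ R).indicator (fun x => B.flip (f c₀) (k x)) x := fun k x => hBg (k x) x
  refine ⟨∫ x in D, B (((x - c₀) ^ 2)⁻¹) (h x), ?_, ?_⟩
  · have d1 := hasFDerivAt_cauchyTransform_of_le B hB hD hDm hhm hhb
      (by positivity : 0 ≤ l + M / R) hhl
    have d2 : HasFDerivAt (fun c => B.flip (f c₀) (-Real.pi * (starRingEnd ℂ) (c - c₀)))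
        (-(Real.pi • (B.flip (f c₀)).comp (conjCLE : ℂ →L[ℝ] ℂ))) c₀ := by
      have e : (fun c => B.flip (f c₀) (-Real.pi * (starRingEnd ℂ) (c - c₀))) =
          fun c => (-(Real.pi • (B.flip (f c₀)).comp (conjCLE : ℂ →L[ℝ] ℂ))) (c - c₀) := by
        funext c
        have e1 : -(Real.pi : ℂ) * (starRingEnd ℂ) (c - c₀) =
            (-Real.pi) • (starRingEnd ℂ) (c - c₀) := by
          rw [Complex.real_smul]; push_cast; rfl
        rw [e1, map_smul]
        simp
      rw [e]
      exact (ContinuousLinearMap.hasFDerivAt _).comp c₀ ((hasFDerivAt_id c₀).sub_const c₀)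
    rw [sub_eq_add_neg]
    refine (d1.add d2).congr_of_eventuallyEq ?_
    filter_upwards [ball_mem_nhds c₀ hR] with c hc
    have i1 := integrableOn_bilin_inv_sub B hD hDm hhm hhb c
    have i2 := integrableOn_bilin_inv_sub B hD hDm hgm hgb c
    have i3 : IntegrableOn (fun x : ℂ => (x - c)⁻¹) (ball c₀ R) :=
      (integrableOn_norm_sub_inv isBounded_ball c).mono' (by fun_prop)
        (.of_forall fun x => by rw [norm_inv])
    have e2 : ∫ x in D, B ((x - c)⁻¹) (g x) =
        B.flip (f c₀) (-Real.pi * (starRingEnd ℂ) (c - c₀)) := by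
      rw [← setIntegral_ball_inv_sub hc, ← ContinuousLinearMap.integral_comp_comm _ i3]
      simp only [hind fun x => (x - c)⁻¹]
      rw [setIntegral_indicator measurableSet_ball, Set.inter_eq_right.2 hsub]
    rw [Pi.add_apply, ← e2, ← integral_add i1 i2]
    refine integral_congr_ae (.of_forall fun x => ?_)
    simp [hh]
  · refine (tendsto_setIntegral_sdiff_balls
      (integrableOn_bilin_inv_sub_sq B hD hDm hhm hhl) c₀ c₁).congr' ?_
    filter_upwards [Ioo_mem_nhdsGT (half_pos hdist)] with ε hε
    have i1 := integrableOn_bilin_inv_sub_sq_sdiff B hD hDm hhm hhb c₀ c₁ hε.1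
    have i2 := integrableOn_bilin_inv_sub_sq_sdiff B hD hDm hgm hgb c₀ c₁ hε.1
    -- The hole about `c₁` misses the disc, so what remains of the disc is a true annulus.
    have hset : (D \ (ball c₀ ε ∪ ball c₁ ε)) ∩ ball c₀ R = ball c₀ R \ ball c₀ ε := by
      ext x
      simp only [Set.mem_inter_iff, Set.mem_sdiff, Set.mem_union, not_or]
      refine ⟨fun hx => ⟨hx.2, hx.1.2.1⟩, fun hx => ⟨⟨hsub hx.1, hx.2, fun h3 => ?_⟩, hx.1⟩⟩
      have h1 := (hRl x hx.1).2
      have h2 := dist_triangle_left c₁ c₀ x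
      have h4 := mem_ball.1 h3
      linarith [hε.2]
    have i3 : IntegrableOn (fun x : ℂ => ((x - c₀) ^ 2)⁻¹) (ball c₀ R \ ball c₀ ε) := by
      have := integrableOn_bilin_inv_sub_sq_sdiff (ContinuousLinearMap.mul ℝ ℂ) isBounded_ball
        (measurableSet_ball (x := c₀) (ε := R)) (h := fun _ => 1) aestronglyMeasurable_const
        (M := 1) (fun _ _ => by simp) c₀ c₀ hε.1
      simpa using this
    have e2 : ∫ x in D \ (ball c₀ ε ∪ ball c₁ ε), B (((x - c₀) ^ 2)⁻¹) (g x) = 0 := by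
      simp only [hind fun x => ((x - c₀) ^ 2)⁻¹]
      rw [setIntegral_indicator measurableSet_ball, hset,
        ContinuousLinearMap.integral_comp_comm _ i3, setIntegral_annulus_inv_sq, map_zero]
    rw [← add_zero (∫ x in D \ (ball c₀ ε ∪ ball c₁ ε), B (((x - c₀) ^ 2)⁻¹) (h x)), ← e2,
      ← integral_add i1 i2]
    refine integral_congr_ae (.of_forall fun x => ?_)
    simp [hh]

end

/-! ### The planes of the Clifford algebra and the splitting of the kernel -/

open ComplexConjugate

variable {m : ℕ}

theorem vecCl_smul (r : ℝ) (v : Vec m) : vecCl (r • v) = r • vecCl v := map_smul _ r v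

theorem vecCl_zero : vecCl (0 : Vec m) = 0 := map_zero _

theorem vecCl_mul_self_of_norm_one {J : Vec m} (hJ : ‖J‖ = 1) : vecCl J * vecCl J = -1 := by
  rw [vecCl_mul_self, hJ]
  simp

theorem vecCl_mul_vecCl_mul_of_norm_one {J : Vec m} (hJ : ‖J‖ = 1) (x : Cl m) :
    vecCl J * (vecCl J * x) = -x := by
  rw [← mul_assoc, vecCl_mul_self_of_norm_one hJ, neg_one_mul]

/-- The map `u + i v ↦ u + J v` from `ℂ` to `Cl_m`. -/
def planeMap (J : Vec m) : ℂ →ₗ[ℝ] Cl m where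
  toFun z := algebraMap ℝ (Cl m) z.re + z.im • vecCl J
  map_add' z w := by
    simp only [add_re, add_im, map_add, add_smul]
    abel
  map_smul' r z := by
    simp only [smul_re, smul_im, smul_eq_mul, map_mul, mul_smul, RingHom.id_apply, smul_add]
    rw [Algebra.smul_def r (algebraMap ℝ (Cl m) z.re)]

theorem planeMap_apply (J : Vec m) (z : ℂ) :
    planeMap J z = algebraMap ℝ (Cl m) z.re + z.im • vecCl J := rfl

theorem planeMap_eq_smul_one_add (J : Vec m) (z : ℂ) :
    planeMap J z = z.re • 1 + z.im • vecCl J := by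
  rw [planeMap_apply, Algebra.algebraMap_eq_smul_one]

@[simp] theorem planeMap_one (J : Vec m) : planeMap J 1 = 1 := by
  simp [planeMap_eq_smul_one_add]

@[simp] theorem planeMap_I (J : Vec m) : planeMap J I = vecCl J := by
  simp [planeMap_eq_smul_one_add]

theorem planeMap_ofReal (J : Vec m) (r : ℝ) : planeMap J r = algebraMap ℝ (Cl m) r := by
  simp [planeMap_apply]

theorem planeMap_mul {J : Vec m} (hJ : ‖J‖ = 1) (z w : ℂ) :
    planeMap J (z * w) = planeMap J z * planeMap J w := by
  simp only [planeMap_eq_smul_one_add, mul_re, mul_im, add_mul, mul_add, smul_mul_assoc,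
    mul_smul_comm, one_mul, mul_one, vecCl_mul_self_of_norm_one hJ]
  module

/-- With `α = (1 - J I)/2` and `β = (1 + J I)/2`, one has `α + β = 1` and `(α - β) I = J`. Thus an
element of `ℂ_J` is rewritten with coefficients in `ℂ_I` on the right, where it can be multiplied by
`b`. -/
theorem planeMap_eq {I J : Vec m} (hI : ‖I‖ = 1) (a b : ℂ) :
    planeMap J a * planeMap I b = (1 / 2 : ℝ) • (1 - vecCl J * vecCl I) * planeMap I (a * b) +
      (1 / 2 : ℝ) • (1 + vecCl J * vecCl I) * planeMap I (conj a * b) := by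
  rw [planeMap_mul hI, planeMap_mul hI]
  simp only [planeMap_eq_smul_one_add, conj_re, conj_im, add_mul, sub_mul, mul_add, smul_mul_assoc,
    mul_smul_comm, one_mul, mul_one, mul_assoc, vecCl_mul_self_of_norm_one hI,
    mul_neg]
  module

theorem inverse_planeMap {J : Vec m} (hJ : ‖J‖ = 1) {z : ℂ} (hz : z ≠ 0) :
    Ring.inverse (planeMap J z) = planeMap J z⁻¹ := by
  let u : (Cl m)ˣ := ⟨planeMap J z, planeMap J z⁻¹,
    by rw [← planeMap_mul hJ, mul_inv_cancel₀ hz, planeMap_one],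
    by rw [← planeMap_mul hJ, inv_mul_cancel₀ hz, planeMap_one]⟩
  exact Ring.inverse_unit u

@[simp] theorem slicePt_zero_coord (J : Vec m) (z : ℂ) : slicePt J z 0 = z.re := rfl

@[simp] theorem vec_slicePt (J : Vec m) (z : ℂ) : vec (slicePt J z) = z.im • J := by
  ext i
  simp [vec, slicePt]

theorem para_ext {x y : Para m} (h0 : x 0 = y 0) (h : vec x = vec y) : x = y := by
  ext i
  refine Fin.cases h0 (fun j => ?_) i
  exact congrArg (fun v : Vec m => v j) h

theorem paraCl_slicePt (J : Vec m) (z : ℂ) : paraCl (slicePt J z) = planeMap J z := by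
  rw [paraCl, vec_slicePt, vecCl_smul, planeMap_apply, slicePt_zero_coord]

theorem star_vecCl (v : Vec m) : star (vecCl v) = -vecCl v := CliffordAlgebra.star_ι v

theorem star_planeMap (J : Vec m) (z : ℂ) : star (planeMap J z) = planeMap J (conj z) := by
  rw [planeMap_apply, star_add, CliffordAlgebra.star_algebraMap, CliffordAlgebra.star_smul,
    star_vecCl, planeMap_apply]
  simp

theorem norm_sq_para (x : Para m) : ‖x‖ ^ 2 = x 0 ^ 2 + ‖vec x‖ ^ 2 := by
  rw [EuclideanSpace.norm_sq_eq, EuclideanSpace.norm_sq_eq, Fin.sum_univ_succ]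
  simp [vec]

theorem norm_slicePt {J : Vec m} (hJ : ‖J‖ = 1) (z : ℂ) : ‖slicePt J z‖ = ‖z‖ := by
  have h : ‖slicePt J z‖ ^ 2 = ‖z‖ ^ 2 := by
    rw [norm_sq_para, vec_slicePt, norm_smul, hJ, mul_one, Real.norm_eq_abs, sq_abs,
      slicePt_zero_coord, ← Complex.normSq_eq_norm_sq, Complex.normSq_apply]
    ring
  exact (pow_left_inj₀ (norm_nonneg _) (norm_nonneg _) two_ne_zero).1 h

theorem norm_unitVec {q : Para m} (hq : q ∈ nonreal m) : ‖unitVec q‖ = 1 := by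
  have : ‖vec q‖ ≠ 0 := norm_ne_zero_iff.2 hq
  rw [unitVec, norm_smul, norm_inv, norm_norm, inv_mul_cancel₀ this]

theorem slicePt_unitVec_planeCoord {q : Para m} (hq : q ∈ nonreal m) :
    slicePt (unitVec q) (planeCoord q) = q := by
  have : ‖vec q‖ ≠ 0 := norm_ne_zero_iff.2 hq
  refine para_ext rfl ?_
  rw [vec_slicePt, planeCoord, unitVec, smul_smul, mul_inv_cancel₀ this, one_smul]

/-- The representation formula for the Cauchy kernel. -/
theorem cauchyKernel_slicePt {I : Vec m} (hI : ‖I‖ = 1) {q : Para m} (hq : q ∈ nonreal m) {z : ℂ}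
    (h1 : z ≠ planeCoord q) (h2 : z ≠ conj (planeCoord q)) :
    cauchyKernel q (slicePt I z) = alpha I q * planeMap I ((z - planeCoord q)⁻¹) +
      beta I q * planeMap I ((z - conj (planeCoord q))⁻¹) := by
  have hJ := norm_unitVec hq
  set c := planeCoord q with hc
  set J := unitVec q with hJd
  have hqc : paraCl q = planeMap J c := by
    rw [← paraCl_slicePt, slicePt_unitVec_planeCoord hq]
  -- The coefficients are real, so the quadratic lies in the commutative plane of `q` and factors
  -- there as over `ℂ`.
  have hN : paraCl q ^ 2 - (2 * slicePt I z 0) • paraCl q +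
      algebraMap ℝ (Cl m) (‖slicePt I z‖ ^ 2) = planeMap J ((c - z) * (c - conj z)) := by
    have e : (c - z) * (c - conj z) = c * c - ((2 * z.re : ℝ) : ℂ) * c + ((‖z‖ ^ 2 : ℝ) : ℂ) := by
      have e1 : ((2 * z.re : ℝ) : ℂ) = z + conj z := (Complex.add_conj z).symm
      have e2 : ((‖z‖ ^ 2 : ℝ) : ℂ) = z * conj z := by
        rw [Complex.mul_conj, Complex.normSq_eq_norm_sq]
      rw [e1, e2]
      ring
    rw [e, map_add, map_sub, planeMap_mul hJ, planeMap_mul hJ, planeMap_ofReal, planeMap_ofReal,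
      hqc, slicePt_zero_coord, norm_slicePt hI, sq, Algebra.smul_def]
  have n1 : c - z ≠ 0 := sub_ne_zero.2 h1.symm
  have n2 : c - conj z ≠ 0 := by
    intro h
    apply h2
    rw [sub_eq_zero.1 h, conj_conj]
  have n3 : conj c - conj z ≠ 0 := by
    rw [← map_sub]
    exact (map_ne_zero _).2 n1
  rw [cauchyKernel, hN, inverse_planeMap hJ (mul_ne_zero n1 n2), hqc, paraCl_slicePt,
    star_planeMap, mul_sub, ← planeMap_mul hJ]
  have k1 := planeMap_eq (J := J) hI (((c - z) * (c - conj z))⁻¹ * c) 1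
  have k2 := planeMap_eq (J := J) hI (((c - z) * (c - conj z))⁻¹) (conj z)
  rw [planeMap_one, mul_one, mul_one, mul_one] at k1
  rw [k1, k2]
  change -(alpha I q * _ + beta I q * _ - (alpha I q * _ + beta I q * _)) = _
  -- In each coefficient the numerator, `c - z̄` for `α` and `c̄ - z̄` for `β`, cancels one factor
  -- of the denominator.
  have s1 : (z - c)⁻¹ = -(((c - z) * (c - conj z))⁻¹ * c - ((c - z) * (c - conj z))⁻¹ * conj z) := by
    rw [← mul_sub, mul_inv, mul_assoc, inv_mul_cancel₀ n2, mul_one, ← inv_neg, neg_sub]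
  have s2 : (z - conj c)⁻¹ = -(conj (((c - z) * (c - conj z))⁻¹ * c) -
      conj (((c - z) * (c - conj z))⁻¹) * conj z) := by
    simp only [map_mul, map_inv₀, map_sub, conj_conj]
    rw [← mul_sub, mul_inv, mul_comm (conj c - conj z)⁻¹, mul_assoc, inv_mul_cancel₀ n3, mul_one,
      ← inv_neg, neg_sub]
  rw [s1, s2, map_neg, map_neg, map_sub, map_sub, mul_neg, mul_neg,
    mul_sub (alpha I q), mul_sub (beta I q)]
  abel

/-! ### Derivatives of the kernel along curves -/

/-- Left multiplication on `Cl_m` as a continuous bilinear map. -/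
def mulL (m : ℕ) : Cl m →L[ℝ] Cl m →L[ℝ] Cl m :=
  (LinearMap.mul ℝ (Cl m)).toContinuousBilinearMap

@[simp] theorem mulL_apply (x y : Cl m) : mulL m x y = x * y := rfl

/-- The action of `ℂ` on `Cl_m` by left multiplication with elements of `ℂ_J`. -/
def planeBilin (J : Vec m) : ℂ →L[ℝ] Cl m →L[ℝ] Cl m :=
  (mulL m).comp (LinearMap.toContinuousLinearMap (planeMap J))

@[simp] theorem planeBilin_apply (J : Vec m) (z : ℂ) (y : Cl m) :
    planeBilin J z y = planeMap J z * y := rfl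

theorem hasDerivAt_mul {u v : ℝ → Cl m} {u' v' : Cl m} {t : ℝ} (hu : HasDerivAt u u' t)
    (hv : HasDerivAt v v' t) :
    HasDerivAt (fun s => u s * v s) (u t * v' + u' * v t) t :=
  (mulL m).hasDerivAt_of_bilinear (fun _ => hu) (fun _ => hv)

theorem hasDerivAt_planeMap (J : Vec m) {g : ℝ → ℂ} {g' : ℂ} {t : ℝ} (hg : HasDerivAt g g' t) :
    HasDerivAt (fun s => planeMap J (g s)) (planeMap J g') t :=
  (LinearMap.toContinuousLinearMap (planeMap J)).hasFDerivAt.comp_hasDerivAt t hg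

theorem hasDerivAt_vecCl {g : ℝ → Vec m} {g' : Vec m} {t : ℝ} (hg : HasDerivAt g g' t) :
    HasDerivAt (fun s => vecCl (g s)) (vecCl g') t :=
  (LinearMap.toContinuousLinearMap
    (CliffordAlgebra.ι (negSq m))).hasFDerivAt.comp_hasDerivAt t hg

theorem hasDerivAt_alpha (I : Vec m) {γ : ℝ → Para m} {J' : Vec m} {t : ℝ}
    (hJ : HasDerivAt (fun s => unitVec (γ s)) J' t) :
    HasDerivAt (fun s => alpha I (γ s)) (-((1 / 2 : ℝ) • (vecCl J' * vecCl I))) t := by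
  have h := ((hasDerivAt_mul (hasDerivAt_vecCl hJ) (hasDerivAt_const t (vecCl I))).const_sub
    1).const_smul (1 / 2 : ℝ)
  convert! h using 1
  rw [mul_zero, zero_add, smul_neg]

theorem hasDerivAt_beta (I : Vec m) {γ : ℝ → Para m} {J' : Vec m} {t : ℝ}
    (hJ : HasDerivAt (fun s => unitVec (γ s)) J' t) :
    HasDerivAt (fun s => beta I (γ s)) ((1 / 2 : ℝ) • (vecCl J' * vecCl I)) t := by
  have h := ((hasDerivAt_mul (hasDerivAt_vecCl hJ) (hasDerivAt_const t (vecCl I))).const_add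
    1).const_smul (1 / 2 : ℝ)
  convert! h using 1
  rw [mul_zero, zero_add]

theorem hasDerivAt_conj {g : ℝ → ℂ} {g' : ℂ} {t : ℝ} (hg : HasDerivAt g g' t) :
    HasDerivAt (fun s => conj (g s)) (conj g') t :=
  (conjCLE : ℂ →L[ℝ] ℂ).hasFDerivAt.comp_hasDerivAt t hg

theorem hasDerivAt_const_sub_inv {g : ℝ → ℂ} {g' z : ℂ} {t : ℝ} (hg : HasDerivAt g g' t)
    (hz : z ≠ g t) : HasDerivAt (fun s => (z - g s)⁻¹) (g' * ((z - g t) ^ 2)⁻¹) t := by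
  have h := (hg.const_sub z).inv (sub_ne_zero.2 hz)
  convert! h using 1
  rw [neg_neg, div_eq_mul_inv]

/-- Product rule for the split kernel. The `J'` term carries only a difference of simple poles,
since `α` and `β` vary oppositely; the double poles come from `c'` alone. -/
theorem hasDerivAt_cauchyKernel {I : Vec m} (hI : ‖I‖ = 1) {γ : ℝ → Para m} {t : ℝ} {c' : ℂ}
    {J' : Vec m} (hγ : ∀ᶠ s in 𝓝 t, γ s ∈ nonreal m)
    (hc : HasDerivAt (fun s => planeCoord (γ s)) c' t)
    (hJ : HasDerivAt (fun s => unitVec (γ s)) J' t) {z : ℂ}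
    (h1 : z ≠ planeCoord (γ t)) (h2 : z ≠ conj (planeCoord (γ t))) :
    HasDerivAt (fun s => cauchyKernel (γ s) (slicePt I z))
      (-((1 / 2 : ℝ) • (vecCl J' * vecCl I)) * (planeMap I ((z - planeCoord (γ t))⁻¹) -
        planeMap I ((z - conj (planeCoord (γ t)))⁻¹)) +
      (alpha I (γ t) * (planeMap I c' * planeMap I (((z - planeCoord (γ t)) ^ 2)⁻¹)) +
        beta I (γ t) * (planeMap I (conj c') *
          planeMap I (((z - conj (planeCoord (γ t))) ^ 2)⁻¹)))) t := by
  have hcc := hasDerivAt_conj hc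
  have d := (hasDerivAt_mul (hasDerivAt_alpha I hJ)
      (hasDerivAt_planeMap I (hasDerivAt_const_sub_inv hc h1))).add
    (hasDerivAt_mul (hasDerivAt_beta I hJ)
      (hasDerivAt_planeMap I (hasDerivAt_const_sub_inv hcc h2)))
  have e1 : ∀ᶠ s in 𝓝 t, z ≠ planeCoord (γ s) :=
    hc.continuousAt.eventually_ne h1.symm |>.mono fun _ h => h.symm
  have e2 : ∀ᶠ s in 𝓝 t, z ≠ conj (planeCoord (γ s)) :=
    hcc.continuousAt.eventually_ne h2.symm |>.mono fun _ h => h.symm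
  have e : (fun s => cauchyKernel (γ s) (slicePt I z)) =ᶠ[𝓝 t]
      fun s => alpha I (γ s) * planeMap I ((z - planeCoord (γ s))⁻¹) +
        beta I (γ s) * planeMap I ((z - conj (planeCoord (γ s)))⁻¹) := by
    filter_upwards [hγ, e1, e2] with s hs hs1 hs2
    exact cauchyKernel_slicePt hI hs hs1 hs2
  refine HasDerivAt.congr_of_eventuallyEq ?_ e
  convert! d using 1
  rw [planeMap_mul hI, planeMap_mul hI, mul_sub, neg_mul, neg_mul]
  abel

/-! ### Axially symmetric sets and functions on them -/

theorem planeCoord_slicePt_mem {D : Set ℂ} (hconj : ∀ z ∈ D, star z ∈ D) {J : Vec m}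
    (hJ : ‖J‖ = 1) {z : ℂ} (hz : z ∈ D) : planeCoord (slicePt J z) ∈ D := by
  have h : ‖vec (slicePt J z)‖ = |z.im| := by
    rw [vec_slicePt, norm_smul, hJ, mul_one, Real.norm_eq_abs]
  rcases abs_choice z.im with h1 | h1
  · have e : planeCoord (slicePt J z) = z := Complex.ext rfl (h.trans h1)
    rwa [e]
  · have e : planeCoord (slicePt J z) = star z := Complex.ext rfl (h.trans h1)
    rw [e]
    exact hconj z hz

theorem planeCoord_mem {D : Set ℂ} (hconj : ∀ z ∈ D, star z ∈ D) {q : Para m}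
    (hq : q ∈ axialSet m D) : planeCoord q ∈ D := by
  simp only [axialSet, Set.mem_iUnion] at hq
  obtain ⟨J, hJ, z, hz, rfl⟩ := hq
  exact planeCoord_slicePt_mem hconj (mem_sphere_zero_iff_norm.1 hJ) hz

theorem slicePt_mem_axialSet {D : Set ℂ} {J : Vec m} (hJ : ‖J‖ = 1) {z : ℂ} (hz : z ∈ D) :
    slicePt J z ∈ axialSet m D :=
  Set.mem_biUnion (mem_sphere_zero_iff_norm.2 hJ) ⟨z, hz, rfl⟩

theorem planeSet_axialSet {D : Set ℂ} (hconj : ∀ z ∈ D, star z ∈ D) {I : Vec m}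
    (hI : ‖I‖ = 1) : planeSet (axialSet m D) I = D := by
  ext z
  refine ⟨fun hz => ?_, fun hz => slicePt_mem_axialSet hI hz⟩
  have h1 := planeCoord_mem hconj hz
  have h : ‖vec (slicePt I z)‖ = |z.im| := by
    rw [vec_slicePt, norm_smul, hI, mul_one, Real.norm_eq_abs]
  rcases abs_choice z.im with h2 | h2
  · have e : planeCoord (slicePt I z) = z := Complex.ext rfl (h.trans h2)
    rwa [e] at h1
  · have e : planeCoord (slicePt I z) = star z := Complex.ext rfl (h.trans h2)
    rw [e] at h1
    simpa using hconj _ h1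

theorem isBounded_of_isBounded_axialSet {D : Set ℂ} {I : Vec m} (hI : ‖I‖ = 1)
    (h : Bornology.IsBounded (axialSet m D)) : Bornology.IsBounded D := by
  obtain ⟨C, hC⟩ := isBounded_iff_forall_norm_le.1 h
  refine isBounded_iff_forall_norm_le.2 ⟨C, fun z hz => ?_⟩
  rw [← norm_slicePt hI]
  exact hC _ (slicePt_mem_axialSet hI hz)

/-- The map `z ↦ u + J v` as a linear map. -/
def slicePtₗ (J : Vec m) : ℂ →ₗ[ℝ] Para m where
  toFun := slicePt J
  map_add' z w := para_ext rfl (by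
    rw [vec_slicePt, add_im, add_smul]
    ext i
    simp [vec, slicePt])
  map_smul' r z := para_ext (by simp) (by
    ext i
    simp [vec, slicePt, mul_assoc])

theorem differentiable_slicePt (J : Vec m) : Differentiable ℝ (slicePt J) :=
  (LinearMap.toContinuousLinearMap (slicePtₗ J)).differentiable

theorem IsC1Closure.differentiableAt {Ω : Set (Para m)} {f : Para m → Cl m}
    (hf : IsC1Closure Ω f) {x : Para m} (hx : x ∈ Ω) : DifferentiableAt ℝ f x := by
  obtain ⟨g, g', -, -, h⟩ := hf
  exact (h x hx).2.differentiableAt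

theorem IsC1Closure.exists_norm_le {Ω : Set (Para m)} (hΩ : Bornology.IsBounded Ω)
    {f : Para m → Cl m} (hf : IsC1Closure Ω f) : ∃ M, ∀ x ∈ Ω, ‖f x‖ ≤ M := by
  obtain ⟨g, g', hg, -, h⟩ := hf
  obtain ⟨M, hM⟩ := hΩ.isCompact_closure.exists_bound_of_continuousOn hg
  exact ⟨M, fun x hx => (h x hx).1 ▸ hM x (subset_closure hx)⟩

theorem conj_planeCoord_ne {q : Para m} (hq : q ∈ nonreal m) :
    conj (planeCoord q) ≠ planeCoord q := by
  intro h
  have h1 : -‖vec q‖ = ‖vec q‖ := congrArg Complex.im h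
  have h2 : 0 < ‖vec q‖ := norm_pos_iff.2 hq
  linarith

theorem eventually_nonreal {γ : ℝ → Para m} {t : ℝ}
    (hc : ContinuousAt (fun s => planeCoord (γ s)) t) (ht : γ t ∈ nonreal m) :
    ∀ᶠ s in 𝓝 t, γ s ∈ nonreal m := by
  have h : ContinuousAt (fun s => (planeCoord (γ s)).im) t :=
    Complex.continuous_im.continuousAt.comp hc
  have h0 : (planeCoord (γ t)).im ≠ 0 := norm_ne_zero_iff.2 ht
  filter_upwards [h.eventually_ne h0] with s hs
  exact norm_ne_zero_iff.1 hs

/-- The Cauchy transform of `f` on the set `D` of the plane `ℂ_I`. -/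
def planeTransform (D : Set ℂ) (I : Vec m) (f : Para m → Cl m) (c : ℂ) : Cl m :=
  ∫ z in D, planeBilin I ((z - c)⁻¹) (f (slicePt I z))

/-! ### The Teodorescu transform along a curve -/

section

variable {D : Set ℂ} {I : Vec m} {f : Para m → Cl m}

theorem continuousOn_comp_slicePt (hI : ‖I‖ = 1) (hf : IsC1Closure (axialSet m D) f) :
    ContinuousOn (fun z => f (slicePt I z)) D := fun z hz =>
  ((hf.differentiableAt (slicePt_mem_axialSet hI hz)).comp z
    (differentiable_slicePt I z)).continuousAt.continuousWithinAt

theorem integrableOn_planeBilin_inv_sub (hD : IsOpen D) (hI : ‖I‖ = 1)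
    (hbdd : Bornology.IsBounded (axialSet m D)) (hf : IsC1Closure (axialSet m D) f) (c : ℂ) :
    IntegrableOn (fun z => planeBilin I ((z - c)⁻¹) (f (slicePt I z))) D := by
  obtain ⟨M, hM⟩ := hf.exists_norm_le hbdd
  exact integrableOn_bilin_inv_sub (planeBilin I) (isBounded_of_isBounded_axialSet hI hbdd)
    hD.measurableSet ((continuousOn_comp_slicePt hI hf).aestronglyMeasurable hD.measurableSet)
    (fun z hz => hM _ (slicePt_mem_axialSet hI hz)) c

theorem ae_cauchyKernel_mul_eq (hI : ‖I‖ = 1) {q : Para m} (hq : q ∈ nonreal m) (D : Set ℂ)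
    (f : Para m → Cl m) :
    (fun z => cauchyKernel q (slicePt I z) * f (slicePt I z)) =ᵐ[volume.restrict D]
      fun z => mulL m (alpha I q) (planeBilin I ((z - planeCoord q)⁻¹) (f (slicePt I z))) +
        mulL m (beta I q) (planeBilin I ((z - conj (planeCoord q))⁻¹) (f (slicePt I z))) := by
  filter_upwards [ae_restrict_of_ae (Measure.ae_ne volume (planeCoord q)),
    ae_restrict_of_ae (Measure.ae_ne volume (conj (planeCoord q)))] with z h1 h2
  rw [cauchyKernel_slicePt hI hq h1 h2]
  simp only [add_mul, mul_assoc, mulL_apply, planeBilin_apply]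

theorem integrableOn_cauchyKernel_mul (hD : IsOpen D) (hI : ‖I‖ = 1)
    (hbdd : Bornology.IsBounded (axialSet m D)) (hf : IsC1Closure (axialSet m D) f) {q : Para m}
    (hq : q ∈ nonreal m) :
    IntegrableOn (fun z => cauchyKernel q (slicePt I z) * f (slicePt I z)) D := by
  have i := integrableOn_planeBilin_inv_sub hD hI hbdd hf
  exact (((mulL m (alpha I q)).integrable_comp (i (planeCoord q))).add
    ((mulL m (beta I q)).integrable_comp (i (conj (planeCoord q))))).congr
    (ae_cauchyKernel_mul_eq hI hq D f).symm

theorem sliceT_eq (hD : IsOpen D) (hconj : ∀ z ∈ D, star z ∈ D) (hI : ‖I‖ = 1)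
    (hbdd : Bornology.IsBounded (axialSet m D)) (hf : IsC1Closure (axialSet m D) f) {q : Para m}
    (hq : q ∈ nonreal m) :
    sliceT (axialSet m D) I f q = -(1 / (2 * Real.pi)) •
      (alpha I q * planeTransform D I f (planeCoord q) +
        beta I q * planeTransform D I f (conj (planeCoord q))) := by
  have i := integrableOn_planeBilin_inv_sub hD hI hbdd hf
  rw [sliceT, planeSet_axialSet hconj hI, integral_congr_ae (ae_cauchyKernel_mul_eq hI hq D f),
    integral_add ((mulL m (alpha I q)).integrable_comp (i (planeCoord q)))
      ((mulL m (beta I q)).integrable_comp (i (conj (planeCoord q)))),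
    ContinuousLinearMap.integral_comp_comm _ (i _), ContinuousLinearMap.integral_comp_comm _ (i _)]
  rfl

/-- Both centres are always excised, so the values there, where the kernel formula fails, do not
matter. -/
theorem HasPV.congr {U : Set ℂ} (hU : MeasurableSet U) {c : ℂ} {g h : ℂ → Cl m} {P : Cl m}
    (hg : HasPV U c g P) (hgh : ∀ z, z ≠ c → z ≠ star c → h z = g z) : HasPV U c h P := by
  have key : ∀ ε : ℝ, 0 < ε →
      Set.EqOn g h (U \ (ball c ε ∪ ball (star c) ε)) := by
    intro ε hε z hz
    refine (hgh z ?_ ?_).symm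
    · rintro rfl
      exact hz.2 (Or.inl (mem_ball_self hε))
    · rintro rfl
      exact hz.2 (Or.inr (mem_ball_self hε))
  have hm : ∀ ε : ℝ, MeasurableSet (U \ (ball c ε ∪ ball (star c) ε)) := fun ε =>
    hU.diff (measurableSet_ball.union measurableSet_ball)
  refine ⟨fun ε hε => (hg.1 ε hε).congr_fun (key ε hε) (hm ε), hg.2.congr' ?_⟩
  filter_upwards [self_mem_nhdsWithin] with ε hε
  exact setIntegral_congr_fun (hm ε) (key ε hε)

theorem HasPV.add {U : Set ℂ} {c : ℂ} {g h : ℂ → Cl m} {P Q : Cl m}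
    (hg : HasPV U c g P) (hh : HasPV U c h Q) : HasPV U c (fun z => g z + h z) (P + Q) := by
  refine ⟨fun ε hε => (hg.1 ε hε).add (hh.1 ε hε), (hg.2.add hh.2).congr' ?_⟩
  filter_upwards [self_mem_nhdsWithin] with ε hε
  exact (integral_add (hg.1 ε hε) (hh.1 ε hε)).symm

theorem HasPV.const_mul {U : Set ℂ} {c : ℂ} {g : ℂ → Cl m} {P : Cl m}
    (hg : HasPV U c g P) (a : Cl m) : HasPV U c (fun z => a * g z) (a * P) := by
  refine ⟨fun ε hε => (mulL m a).integrable_comp (hg.1 ε hε),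
    (((mulL m a).continuous.tendsto P).comp hg.2).congr' ?_⟩
  filter_upwards [self_mem_nhdsWithin] with ε hε
  exact ((mulL m a).integral_comp_comm (hg.1 ε hε)).symm

theorem hasPV_of_integrableOn {U : Set ℂ} {g : ℂ → Cl m} (hg : IntegrableOn g U) (c : ℂ) :
    HasPV U c g (∫ z in U, g z) :=
  ⟨fun _ _ => hg.mono_set Set.sdiff_subset, tendsto_setIntegral_sdiff_balls hg c (star c)⟩

/-- The derivative of the slice Teodorescu transform and the principal value of the derivative of
the Cauchy kernel, along an arbitrary curve through `q`. -/
theorem exists_hasDerivAt_sliceT (hD : IsOpen D) (hconj : ∀ z ∈ D, star z ∈ D) (hI : ‖I‖ = 1)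
    (hbdd : Bornology.IsBounded (axialSet m D)) (hf : IsC1Closure (axialSet m D) f) {q : Para m}
    (hq : q ∈ nonreal m) (hqD : q ∈ axialSet m D) :
    ∃ W V₁ V₂ : Cl m, ∀ (γ : ℝ → Para m) (t : ℝ) (c' : ℂ) (J' : Vec m), γ t = q →
      HasDerivAt (fun s => planeCoord (γ s)) c' t →
      HasDerivAt (fun s => unitVec (γ s)) J' t →
      ∀ P, P = -((1 / 2 : ℝ) • (vecCl J' * vecCl I)) * W +
        (alpha I q * (planeMap I c' * V₁) + beta I q * (planeMap I (conj c') * V₂)) →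
      HasPV (planeSet (axialSet m D) I) (planeCoord q)
        (fun z => deriv (fun s => cauchyKernel (γ s) (slicePt I z)) t * f (slicePt I z)) P ∧
      HasDerivAt (fun s => sliceT (axialSet m D) I f (γ s))
        ((2 * Real.pi)⁻¹ • (-P + Real.pi •
          (alpha I q * (planeMap I (conj c') * f (slicePt I (planeCoord q))) +
            beta I q * (planeMap I c' * f (slicePt I (conj (planeCoord q))))))) t := by
  have hDm := hD.measurableSet
  have hDb := isBounded_of_isBounded_axialSet hI hbdd
  have hfc := continuousOn_comp_slicePt hI hf
  obtain ⟨M, hM'⟩ := hf.exists_norm_le hbdd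
  have hM : ∀ z ∈ D, ‖f (slicePt I z)‖ ≤ M := fun z hz => hM' _ (slicePt_mem_axialSet hI hz)
  have hfm : AEStronglyMeasurable (fun z => f (slicePt I z)) (volume.restrict D) :=
    hfc.aestronglyMeasurable hDm
  have hdiff : ∀ z ∈ D, DifferentiableAt ℝ (fun z => f (slicePt I z)) z := fun z hz =>
    (hf.differentiableAt (slicePt_mem_axialSet hI hz)).comp z (differentiable_slicePt I z)
  have hB : ∀ a b y, planeBilin I (a * b) y = planeBilin I a (planeBilin I b y) := by
    intro a b y
    simp only [planeBilin_apply, planeMap_mul hI, mul_assoc]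
  have hc : planeCoord q ∈ D := planeCoord_mem hconj hqD
  have hcc : conj (planeCoord q) ∈ D := hconj _ hc
  have hne := conj_planeCoord_ne hq
  have hi := integrableOn_planeBilin_inv_sub hD hI hbdd hf
  obtain ⟨V₁, hV₁, hV₁'⟩ := exists_hasFDerivAt_cauchyTransform (planeBilin I) hB hD hDb hfc hM
    hc hne (hdiff _ hc)
  obtain ⟨V₂, hV₂, hV₂'⟩ := exists_hasFDerivAt_cauchyTransform (planeBilin I) hB hD hDb hfc hM
    hcc hne.symm (hdiff _ hcc)
  -- The witnesses depend on `q` only, not on the curve; this lets different partial derivatives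
  -- cancel in `G`.
  refine ⟨planeTransform D I f (planeCoord q) - planeTransform D I f (conj (planeCoord q)),
    V₁, V₂, ?_⟩
  rintro γ t c' J' rfl hγc hγJ P rfl
  have hev := eventually_nonreal hγc.continuousAt hq
  constructor
  · rw [planeSet_axialSet hconj hI]
    have p1 : HasPV D (planeCoord (γ t)) (fun z => planeBilin I (((z - planeCoord (γ t)) ^ 2)⁻¹)
        (f (slicePt I z))) V₁ :=
      ⟨fun ε hε => integrableOn_bilin_inv_sub_sq_sdiff (planeBilin I) hDb hDm hfm hM _ _ hε, hV₁'⟩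
    have p2 : HasPV D (planeCoord (γ t))
        (fun z => planeBilin I (((z - conj (planeCoord (γ t))) ^ 2)⁻¹) (f (slicePt I z))) V₂ := by
      refine ⟨fun ε hε => ?_, ?_⟩
      · rw [Set.union_comm]
        exact integrableOn_bilin_inv_sub_sq_sdiff (planeBilin I) hDb hDm hfm hM _ _ hε
      · simp only [Set.union_comm (ball (planeCoord (γ t)) _)]
        exact hV₂'
    -- The simple poles are integrable, so this principal value is an ordinary integral.
    have p3 := hasPV_of_integrableOn ((hi (planeCoord (γ t))).sub (hi (conj (planeCoord (γ t)))))
      (planeCoord (γ t))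
    simp only [Pi.sub_apply] at p3
    rw [integral_sub (hi _) (hi _)] at p3
    refine ((p3.const_mul (-((1 / 2 : ℝ) • (vecCl J' * vecCl I)))).add
      (((p1.const_mul (planeMap I c')).const_mul (alpha I (γ t))).add
      ((p2.const_mul (planeMap I (conj c'))).const_mul (beta I (γ t))))).congr hDm
      fun z h1 h2 => ?_
    rw [(hasDerivAt_cauchyKernel hI hev hγc hγJ h1 h2).deriv]
    simp only [planeBilin_apply, add_mul, mul_assoc, sub_mul, Pi.sub_apply]
  · have hW₁ : HasDerivAt (fun s => planeTransform D I f (planeCoord (γ s)))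
        (planeMap I c' * V₁ -
          Real.pi • (planeMap I (conj c') * f (slicePt I (planeCoord (γ t))))) t := by
      have := hV₁.comp_hasDerivAt t hγc
      exact this
    have hW₂ : HasDerivAt (fun s => planeTransform D I f (conj (planeCoord (γ s))))
        (planeMap I (conj c') * V₂ -
          Real.pi • (planeMap I c' * f (slicePt I (conj (planeCoord (γ t)))))) t := by
      have := hV₂.comp_hasDerivAt t (hasDerivAt_conj hγc)
      -- At `c̄` the inner derivative is `conj c'`, and the jump term conjugates it back to `c'`.
      have e := congrArg (planeMap I) (conj_conj c')
      rw [← e]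
      exact this
    have hd := ((hasDerivAt_mul (hasDerivAt_alpha I hγJ) hW₁).add
      (hasDerivAt_mul (hasDerivAt_beta I hγJ) hW₂)).const_smul (-(1 / (2 * Real.pi)))
    refine HasDerivAt.congr_of_eventuallyEq (f := fun s => -(1 / (2 * Real.pi)) •
      (alpha I (γ s) * planeTransform D I f (planeCoord (γ s)) +
        beta I (γ s) * planeTransform D I f (conj (planeCoord (γ s))))) ?_ ?_
    · convert! hd using 1
      rw [neg_smul (1 / (2 * Real.pi)), ← smul_neg (1 / (2 * Real.pi)), one_div (2 * Real.pi)]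
      congr 1
      simp only [mul_sub, mul_smul_comm, smul_add, neg_mul]
      abel
    · filter_upwards [hev] with s hs
      exact sliceT_eq hD hconj hI hbdd hf hs

end

/-! ### Derivatives of the plane coordinate and of the direction -/

theorem vec_add_smul_single_zero (q : Para m) (s : ℝ) :
    vec (q + s • EuclideanSpace.single 0 1) = vec q := by
  ext i
  simp [vec]

theorem vec_add_smul_single_succ (q : Para m) (i : Fin m) (s : ℝ) :
    vec (q + s • EuclideanSpace.single i.succ 1) = vec q + s • EuclideanSpace.single i 1 := by
  ext j
  simp [vec]

theorem hasDerivAt_planeCoord_single_zero (q : Para m) :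
    HasDerivAt (fun s : ℝ => planeCoord (q + s • EuclideanSpace.single 0 1)) 1 0 := by
  have e : (fun s : ℝ => planeCoord (q + s • EuclideanSpace.single 0 1)) =
      fun s : ℝ => planeCoord q + (s : ℂ) := by
    funext s
    apply Complex.ext
    · simp [planeCoord]
    · simp [planeCoord, vec_add_smul_single_zero]
  rw [e]
  exact (hasDerivAt_id (0 : ℝ)).ofReal_comp.const_add _

theorem hasDerivAt_unitVec_single_zero (q : Para m) :
    HasDerivAt (fun s : ℝ => unitVec (q + s • EuclideanSpace.single 0 1)) 0 0 := by
  simp only [unitVec, vec_add_smul_single_zero]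
  exact hasDerivAt_const _ _

theorem hasDerivAt_vec_single_succ (q : Para m) (i : Fin m) :
    HasDerivAt (fun s : ℝ => vec (q + s • EuclideanSpace.single i.succ 1))
      (EuclideanSpace.single i 1) 0 := by
  simp only [vec_add_smul_single_succ]
  simpa using ((hasDerivAt_id (0 : ℝ)).smul_const
    (EuclideanSpace.single i (1 : ℝ) : Vec m)).const_add (vec q)

theorem hasDerivAt_norm_vec_single_succ {q : Para m} (hq : q ∈ nonreal m) (i : Fin m) :
    HasDerivAt (fun s : ℝ => ‖vec (q + s • EuclideanSpace.single i.succ 1)‖)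
      (q i.succ / ‖vec q‖) 0 := by
  have h := (hasDerivAt_vec_single_succ q i).norm_sq
  have h0 : ‖vec q‖ ≠ 0 := norm_ne_zero_iff.2 hq
  have h1 := h.sqrt (by simpa using h0)
  simp only [Real.sqrt_sq (norm_nonneg _), zero_smul, add_zero] at h1
  convert! h1 using 1
  rw [EuclideanSpace.inner_single_right]
  simp [vec, mul_div_mul_left]

theorem hasDerivAt_planeCoord_single_succ {q : Para m} (hq : q ∈ nonreal m) (i : Fin m) :
    HasDerivAt (fun s : ℝ => planeCoord (q + s • EuclideanSpace.single i.succ 1))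
      (((q i.succ / ‖vec q‖ : ℝ) : ℂ) * I) 0 := by
  have e : (fun s : ℝ => planeCoord (q + s • EuclideanSpace.single i.succ 1)) =
      fun s : ℝ => ((q 0 : ℝ) : ℂ) +
        ((‖vec (q + s • EuclideanSpace.single i.succ 1)‖ : ℝ) : ℂ) * I := by
    funext s
    apply Complex.ext
    · simp [planeCoord]
    · simp [planeCoord]
  rw [e]
  exact ((hasDerivAt_norm_vec_single_succ hq i).ofReal_comp.mul_const I).const_add _

theorem hasDerivAt_unitVec_single_succ {q : Para m} (hq : q ∈ nonreal m) (i : Fin m) :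
    HasDerivAt (fun s : ℝ => unitVec (q + s • EuclideanSpace.single i.succ 1))
      (‖vec q‖⁻¹ • EuclideanSpace.single i 1 - (q i.succ / ‖vec q‖ ^ 3) • vec q) 0 := by
  have h0 : ‖vec q‖ ≠ 0 := norm_ne_zero_iff.2 hq
  have h := ((hasDerivAt_norm_vec_single_succ hq i).inv (by simpa using h0)).smul
    (hasDerivAt_vec_single_succ q i)
  convert! h using 1
  simp only [zero_smul, add_zero, Pi.inv_apply, sub_eq_add_neg, ← neg_smul]
  congr 2
  field_simp

theorem hasDerivAt_planeCoord_slicePt {J : Vec m} (hJ : ‖J‖ = 1) (u : ℝ) {t : ℝ} (ht : 0 < t) :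
    HasDerivAt (fun s : ℝ => planeCoord (slicePt J ⟨u, s⟩)) I t := by
  have h : HasDerivAt (fun s : ℝ => (u : ℂ) + (s : ℂ) * I) I t := by
    simpa using ((hasDerivAt_id t).ofReal_comp.mul_const I).const_add (u : ℂ)
  refine h.congr_of_eventuallyEq ?_
  filter_upwards [Ioi_mem_nhds ht] with s (hs : 0 < s)
  apply Complex.ext
  · simp [planeCoord]
  · simp [planeCoord, norm_smul, hJ, abs_of_pos hs]

theorem hasDerivAt_unitVec_slicePt {J : Vec m} (hJ : ‖J‖ = 1) (u : ℝ) {t : ℝ} (ht : 0 < t) :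
    HasDerivAt (fun s : ℝ => unitVec (slicePt J ⟨u, s⟩)) 0 t := by
  refine (hasDerivAt_const t J).congr_of_eventuallyEq ?_
  filter_upwards [Ioi_mem_nhds ht] with s (hs : 0 < s)
  rw [unitVec, vec_slicePt, norm_smul, hJ, mul_one, Real.norm_of_nonneg hs.le, smul_smul,
    inv_mul_cancel₀ hs.ne', one_smul]

theorem sum_sq_eq_norm_vec_sq (q : Para m) : ∑ j : Fin m, q j.succ * q j.succ = ‖vec q‖ ^ 2 := by
  rw [EuclideanSpace.norm_sq_eq]
  simp [vec, sq]

/-- Euler's relation: the direction is homogeneous of degree 0, so its derivative along the vector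
part vanishes. -/
theorem sum_smul_unitVec_derivative {q : Para m} (hq : q ∈ nonreal m) :
    ∑ j : Fin m, q j.succ • (‖vec q‖⁻¹ • EuclideanSpace.single j (1 : ℝ) -
      (q j.succ / ‖vec q‖ ^ 3) • vec q) = 0 := by
  have h0 : ‖vec q‖ ≠ 0 := norm_ne_zero_iff.2 hq
  have e1 : ∑ j : Fin m, q j.succ • (‖vec q‖⁻¹ • EuclideanSpace.single j (1 : ℝ)) =
      ‖vec q‖⁻¹ • vec q := by
    ext k
    simp [vec, Pi.single_apply, mul_comm]
  have e2 : ∑ j : Fin m, q j.succ • ((q j.succ / ‖vec q‖ ^ 3) • vec q) =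
      ‖vec q‖⁻¹ • vec q := by
    simp only [smul_smul, ← Finset.sum_smul]
    congr 1
    simp only [← mul_div_assoc, ← Finset.sum_div]
    rw [sum_sq_eq_norm_vec_sq]
    field_simp
  simp only [smul_sub, Finset.sum_sub_distrib]
  rw [e1, e2, sub_self]

/-! ### Algebra of `α` and `β`, and the operator `G` -/

theorem planeMap_ofReal_mul_I (J : Vec m) (r : ℝ) : planeMap J (r * I) = r • vecCl J := by
  simp [planeMap_eq_smul_one_add]

theorem planeMap_conj_ofReal_mul_I (J : Vec m) (r : ℝ) :
    planeMap J (conj (r * I)) = -(r • vecCl J) := by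
  simp [planeMap_eq_smul_one_add]

theorem planeMap_conj_I (J : Vec m) : planeMap J (conj I) = -vecCl J := by
  simp [planeMap_eq_smul_one_add]

/-- Since `I_q² = I² = -1`, `I_q (1 - I_q I) I = I_q I - 1`. With its companion for `β`, this
matches the radial terms with those of `∂₀`. -/
theorem unitVec_mul_alpha_mul {I : Vec m} (hI : ‖I‖ = 1) {q : Para m} (hq : q ∈ nonreal m)
    (x : Cl m) : vecCl (unitVec q) * (alpha I q * (vecCl I * x)) = -(alpha I q * x) := by
  simp only [alpha, sub_mul, smul_mul_assoc, mul_smul_comm, one_mul, mul_sub, mul_assoc,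
    vecCl_mul_vecCl_mul_of_norm_one hI, vecCl_mul_vecCl_mul_of_norm_one (norm_unitVec hq)]
  module

theorem unitVec_mul_beta_mul {I : Vec m} (hI : ‖I‖ = 1) {q : Para m} (hq : q ∈ nonreal m)
    (x : Cl m) : vecCl (unitVec q) * (beta I q * (vecCl I * x)) = beta I q * x := by
  simp only [beta, add_mul, smul_mul_assoc, mul_smul_comm, one_mul, mul_add, mul_assoc,
    vecCl_mul_vecCl_mul_of_norm_one hI, vecCl_mul_vecCl_mul_of_norm_one (norm_unitVec hq)]
  module

/-- By the parity of the stem function the left side is `(α + β) F₁ + (α - β) I F₂`, and `α + β =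
1`, `(α - β) I = I_q`. -/
theorem IsSlice.alpha_mul_add_beta_mul {D : Set ℂ} (hconj : ∀ z ∈ D, star z ∈ D)
    {f : Para m → Cl m} (hf : IsSlice D f) {I : Vec m} (hI : ‖I‖ = 1) {q : Para m}
    (hq : q ∈ nonreal m) (hqD : q ∈ axialSet m D) :
    alpha I q * f (slicePt I (planeCoord q)) + beta I q * f (slicePt I (star (planeCoord q))) =
      f q := by
  obtain ⟨F₁, F₂, hF, h⟩ := hf
  have hc := planeCoord_mem hconj hqD
  have hIs := mem_sphere_zero_iff_norm.2 hI
  have hq' := h (unitVec q) (mem_sphere_zero_iff_norm.2 (norm_unitVec hq)) _ hc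
  rw [slicePt_unitVec_planeCoord hq] at hq'
  rw [hq', h I hIs _ hc, h I hIs _ (hconj _ hc), (hF _ hc).1, (hF _ hc).2]
  simp only [alpha, beta, add_mul, sub_mul, smul_mul_assoc, one_mul, mul_add, mul_assoc,
    mul_neg, vecCl_mul_vecCl_mul_of_norm_one hI]
  module

/-- Here `T` is the radial part and `X` the factor of the variation of `I_q`. Weighted by `q_j`, the
`X` terms cancel by Euler's relation, while the weights `q_j² / |vec q|` of `T` sum to `|vec q|`. -/
theorem opG_eq {h : Para m → Cl m} {q : Para m} (hq : q ∈ nonreal m) {T₀ T X : Cl m}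
    (h₀ : HasLineDerivAt ℝ h T₀ q (EuclideanSpace.single 0 1))
    (hj : ∀ j : Fin m, HasLineDerivAt ℝ h
      (vecCl (‖vec q‖⁻¹ • EuclideanSpace.single j 1 - (q j.succ / ‖vec q‖ ^ 3) • vec q) * X +
        (q j.succ / ‖vec q‖) • T) q (EuclideanSpace.single j.succ 1)) :
    opG h q = T₀ + vecCl (unitVec q) * T := by
  have h0 : ‖vec q‖ ≠ 0 := norm_ne_zero_iff.2 hq
  have e : ∑ j : Fin m, q j.succ • lineDeriv ℝ h q (EuclideanSpace.single j.succ 1) =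
      ‖vec q‖ • T := by
    have e1 : ∑ j : Fin m, q j.succ • vecCl (‖vec q‖⁻¹ • EuclideanSpace.single j 1 -
        (q j.succ / ‖vec q‖ ^ 3) • vec q) = 0 := by
      simp only [← vecCl_smul]
      have := congrArg vecCl (sum_smul_unitVec_derivative hq)
      rw [vecCl_zero] at this
      rw [← this]
      exact (map_sum (CliffordAlgebra.ι (negSq m)) _ _).symm
    calc _ = ∑ j : Fin m, ((q j.succ • vecCl (‖vec q‖⁻¹ • EuclideanSpace.single j 1 -
          (q j.succ / ‖vec q‖ ^ 3) • vec q)) * X + (q j.succ * q j.succ / ‖vec q‖) • T) := by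
          refine Finset.sum_congr rfl fun j _ => ?_
          rw [(hj j).lineDeriv, smul_add, smul_mul_assoc, smul_smul, mul_div_assoc]
      _ = ‖vec q‖ • T := by
          rw [Finset.sum_add_distrib, ← Finset.sum_mul, e1, zero_mul, zero_add,
            ← Finset.sum_smul, ← Finset.sum_div, sum_sq_eq_norm_vec_sq, sq,
            mul_div_cancel_right₀ _ h0]
  rw [opG, h₀.lineDeriv, e, unitVec, vecCl_smul, smul_mul_assoc, mul_smul_comm, smul_smul]
  congr 2
  field_simp

end SliceClifford

end

/-! ### The derivative formulas and the inversion by `G` -/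

open SliceClifford
theorem mainTheorem2 (m : ℕ) (D : Set ℂ) (hD : IsOpen D) (hconj : ∀ z ∈ D, star z ∈ D)
    (hbdd : Bornology.IsBounded (axialSet m D))
    (hreal : axialSet m D ⊆ nonreal m)
    (f : Para m → Cl m)
    (hf : IsC1Closure (axialSet m D) f)
    (I : Vec m) (hI : ‖I‖ = 1) :
    (∀ q ∈ axialSet m D,
      -- the integral which defines the transform converges absolutely
      MeasureTheory.IntegrableOn
        (fun z : ℂ => cauchyKernel q (slicePt I z) *
          f (slicePt I z))
        (planeSet (axialSet m D) I) ∧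
      -- the derivative with respect to the real part of `q`
      (∃ P T' : Cl m,
        HasPV (planeSet (axialSet m D) I)
          (planeCoord q)
          (fun z => kernelPartial 0 q (slicePt I z) *
            f (slicePt I z)) P ∧
        HasLineDerivAt ℝ (sliceT (axialSet m D) I f) T' q
          (EuclideanSpace.single 0 1) ∧
        (2 * Real.pi) • T' = -P + Real.pi •
          (alpha I q *
              f (slicePt I (planeCoord q)) +
            beta I q *
              f (slicePt I (star (planeCoord q))))) ∧
      -- the derivatives with respect to the other coordinates of `q`
      (∀ i : Fin m, ∃ P T' : Cl m,
        HasPV (planeSet (axialSet m D) I)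
          (planeCoord q)
          (fun z => kernelPartial i.succ q (slicePt I z) *
            f (slicePt I z)) P ∧
        HasLineDerivAt ℝ (sliceT (axialSet m D) I f) T' q
          (EuclideanSpace.single i.succ 1) ∧
        (2 * Real.pi) • T' = -P - (q i.succ / ‖vec q‖) • Real.pi •
          (alpha I q * vecCl I *
              f (slicePt I (planeCoord q)) -
            beta I q * vecCl I *
              f (slicePt I (star (planeCoord q))))) ∧
      -- the derivative with respect to the modulus of the vector part of `q`
      (∃ P T' : Cl m,
        HasPV (planeSet (axialSet m D) I)
          (planeCoord q)
          (fun z => kernelRadial q (slicePt I z) *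
            f (slicePt I z)) P ∧
        HasRadialDeriv
          (sliceT (axialSet m D) I f) T' q ∧
        (2 * Real.pi) • T' = -P - Real.pi •
          (alpha I q * vecCl I *
              f (slicePt I (planeCoord q)) -
            beta I q * vecCl I *
              f (slicePt I (star (planeCoord q))))) ∧
      opG (sliceT (axialSet m D) I f) q =
        alpha I q *
            f (slicePt I (planeCoord q)) +
          beta I q *
            f (slicePt I (star (planeCoord q)))) ∧
    (IsSlice D f → ∀ q ∈ axialSet m D,
      opG (sliceT (axialSet m D) I f) q = f q) := by
  refine (and_iff_left_of_imp fun main hfs q hqD => (main q hqD).2.2.2.2.trans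
    (hfs.alpha_mul_add_beta_mul hconj hI (hreal hqD) hqD)).2 fun q hqD => ?_
  have hq : q ∈ nonreal m := hreal hqD
  have hζ : 0 < ‖vec q‖ := norm_pos_iff.2 hq
  have hpi : 2 * Real.pi ≠ 0 := by positivity
  have hJ := norm_unitVec hq
  obtain ⟨W, V₁, V₂, H⟩ := exists_hasDerivAt_sliceT hD hconj hI hbdd hf hq hqD
  have h₀ := H (fun s => q + s • EuclideanSpace.single 0 1) 0 1 0 (by simp)
    (hasDerivAt_planeCoord_single_zero q) (hasDerivAt_unitVec_single_zero q) _ rfl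
  -- Here `c' = i q_j / |vec q|` is purely imaginary, so `conj c' = -c'`: this is the minus sign
  -- between the `α` and `β` terms.
  have hs := fun i : Fin m => H (fun s => q + s • EuclideanSpace.single i.succ 1) 0 _ _ (by simp)
    (hasDerivAt_planeCoord_single_succ hq i) (hasDerivAt_unitVec_single_succ hq i) _ rfl
  have hr := H (fun ζ => slicePt (unitVec q) ⟨q 0, ζ⟩) ‖vec q‖ Complex.I 0
    (slicePt_unitVec_planeCoord hq) (hasDerivAt_planeCoord_slicePt hJ (q 0) hζ)
    (hasDerivAt_unitVec_slicePt hJ (q 0) hζ) _ rfl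
  refine ⟨?_, ⟨_, _, h₀.1, h₀.2, ?_⟩, fun i => ⟨_, _, (hs i).1, (hs i).2, ?_⟩,
    ⟨_, _, hr.1, hr.2, ?_⟩, ?_⟩
  · rw [planeSet_axialSet hconj hI]
    exact integrableOn_cauchyKernel_mul hD hI hbdd hf hq
  · rw [smul_inv_smul₀ hpi, map_one (starRingEnd ℂ), planeMap_one]
    simp only [one_mul, starRingEnd_apply]
  · rw [smul_inv_smul₀ hpi, sub_eq_add_neg]
    simp only [planeMap_ofReal_mul_I, planeMap_conj_ofReal_mul_I]
    simp only [starRingEnd_apply, neg_mul, mul_neg, smul_mul_assoc, mul_smul_comm, mul_assoc]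
    module
  · rw [smul_inv_smul₀ hpi, sub_eq_add_neg]
    congr 1
    simp only [planeMap_I, planeMap_conj_I]
    simp only [starRingEnd_apply, neg_mul, mul_neg, mul_assoc]
    module
  -- `X` collects what multiplies `J'` in the chain rule; `T` is the value of the `ζ`-derivative.
  · have hG := opG_eq (h := sliceT (axialSet m D) I f) hq
      (X := (2 * Real.pi)⁻¹ • ((1 / 2 : ℝ) • (vecCl I * W)))
      (T := (2 * Real.pi)⁻¹ • (-(alpha I q * (vecCl I * V₁) - beta I q * (vecCl I * V₂)) -
        Real.pi • (alpha I q * (vecCl I * f (slicePt I (planeCoord q))) -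
          beta I q * (vecCl I * f (slicePt I (star (planeCoord q))))))) h₀.2 fun j => by
        have h1 := (hs j).2
        simp only [planeMap_ofReal_mul_I, planeMap_conj_ofReal_mul_I] at h1
        refine HasDerivAt.congr_deriv h1 ?_
        simp only [starRingEnd_apply, neg_mul, mul_neg, smul_mul_assoc, mul_smul_comm, mul_assoc]
        module
    rw [hG]
    -- Multiplying `T` by `I_q` turns its `V₁`, `V₂` terms into the negatives of those of `∂₀`, and
    -- its jump terms into a second copy; the total `2π` cancels the prefactor.
    simp only [mul_smul_comm, mul_sub, mul_neg, unitVec_mul_alpha_mul hI hq,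
      unitVec_mul_beta_mul hI hq, planeMap_one, map_one (starRingEnd ℂ), one_mul, vecCl_zero, zero_mul, smul_zero,
      neg_zero, zero_add, starRingEnd_apply]
    rw [← smul_add, inv_smul_eq_iff₀ hpi]
    module
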